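/- \textbf{Proposition.} Call a commutative additive monoid $\Lambda$ an \emph{affine monoid} if it is cancellative ($\lambda+\mu=\lambda'+\mu$ implies $\lambda=\lambda'$), pointed ($\lambda+\mu=0$ implies $\lambda=\mu=0$) and finitely generated. Let $K$ be a field, and regard $K$ as the $\Lambda$-graded module over the monoid algebra $K[\Lambda]$ which is concentrated in degree $0$ and on which every monomial $x^\lambda$ with $\lambda\neq 0$ acts as zero. For $i\in\mathbb N$ and $\lambda\in\Lambda$ let $\operatorname{Tor}^{K[\Lambda]}_{i,\lambda}(K,K)$ be the degree-$\lambda$ part of the $\Lambda$-graded $K$-module $\operatorname{Tor}^{K[\Lambda]}_i(K,K)$, and put $\beta_i(\lambda;\Lambda)=\dim_K\operatorname{Tor}^{K[\Lambda]}_{i,\lambda}(K,K)$. The Poincar\'e series of $\Lambda$ is the formal series $$P_\Lambda(t,z)=\sum_{i\in\mathbb N}\sum_{\lambda\in\Lambda}\beta_i(\lambda;\Lambda)\,t^i z^\lambda .$$ Formal series over $\Lambda$ are the formal sums $\sum_{\lambda\in\Lambda}c_\lambda(t)z^\lambda$ with $c_\lambda(t)\in\mathbb Z[[t]]$; they are multiplied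 by the rule $z^\lambda z^\mu=z^{\lambda+\mu}$, which makes sense because every element of an affine monoid is a sum of two elements in only finitely many ways. Let $\Lambda_1$ and $\Lambda_2$ be affine monoids. Then all the spaces $\operatorname{Tor}_{i,\lambda}(K,K)$ over $K[\Lambda_1]$, $K[\Lambda_2]$ and $K[\Lambda_1\oplus\Lambda_2]$ are finite-dimensional over $K$, and $$P_{\Lambda_1\oplus\Lambda_2}(t,z)=P_{\Lambda_1}(t,z)\cdot P_{\Lambda_2}(t,z),$$ where the product is taken in the formal series over $\Lambda_1\oplus\Lambda_2$, a series over $\Lambda_1$ (resp. $\Lambda_2$) being regarded as a series over $\Lambda_1\oplus\Lambda_2$ through $z^{\lambda_1}=z^{(\lambda_1,0)}$ (resp. $z^{\lambda_2}=z^{(0,\lambda_2)}$). -/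

import Mathlib

open CategoryTheory CategoryTheory.Limits
open scoped TensorProduct DirectSum

universe u v w

/-- An affine monoid: a commutative additive monoid which is cancellative, pointed and finitely
generated. (Torsion-freeness is not required, in contrast to Mathlib's `IsAffineAddMonoid`, which
in turn does not require pointedness.) -/
class IsPointedAffine (L : Type v) [AddCommMonoid L] : Prop where
  cancel : ∀ a b c : L, a + c = b + c → a = b
  pointed : ∀ a b : L, a + b = 0 → a = 0 ∧ b = 0
  fg : AddMonoid.FG L

/-- The direct sum of two affine monoids is affine. -/
instance IsPointedAffine.prod (L₁ : Type v) (L₂ : Type w) [AddCommMonoid L₁] [AddCommMonoid L₂]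
    [IsPointedAffine L₁] [IsPointedAffine L₂] : IsPointedAffine (L₁ × L₂) where
  cancel a b c h := by
    rw [Prod.ext_iff] at h ⊢
    exact ⟨IsPointedAffine.cancel _ _ _ h.1, IsPointedAffine.cancel _ _ _ h.2⟩
  pointed a b h := by
    rw [Prod.ext_iff] at h
    have h1 := IsPointedAffine.pointed _ _ h.1
    have h2 := IsPointedAffine.pointed _ _ h.2
    exact ⟨Prod.ext h1.1 h2.1, Prod.ext h1.2 h2.2⟩
  fg := by
    have : AddMonoid.FG L₁ := IsPointedAffine.fg
    have : AddMonoid.FG L₂ := IsPointedAffine.fg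
    infer_instance

/-- In an affine monoid every element is a sum of two elements in only finitely many ways. -/
theorem IsPointedAffine.finite_antidiagonal {L : Type v} [AddCommMonoid L] [IsPointedAffine L]
    (l : L) : {p : L × L | p.1 + p.2 = l}.Finite := by
  classical
  obtain ⟨S, hS⟩ := (IsPointedAffine.fg (L := L)).fg_top
  -- the map from the free commutative monoid on the nonzero generators
  let T : Finset L := S.erase 0
  let φ : (T → ℕ) → L := fun n => ∑ t : T, n t • (t : L)
  have hadd : ∀ n m, φ (n + m) = φ n + φ m := by
    intro n m
    simp [φ, add_smul, Finset.sum_add_distrib]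
  have hzero : ∀ n, φ n = 0 → n = 0 := by
    intro n hn
    funext t
    by_contra hne
    have h1 : φ n = n t • (t : L) + ∑ s ∈ Finset.univ.erase t, n s • (s : L) :=
      (Finset.add_sum_erase _ _ (Finset.mem_univ t)).symm
    rw [hn] at h1
    have h2 := (IsPointedAffine.pointed _ _ h1.symm).1
    obtain ⟨k, hk⟩ := Nat.exists_eq_succ_of_ne_zero hne
    rw [hk, Nat.succ_eq_add_one, add_smul, one_smul] at h2
    exact (Finset.ne_of_mem_erase t.2) (IsPointedAffine.pointed _ _ h2).2
  have hsurj : ∀ a : L, ∃ n, φ n = a := by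
    intro a
    have ha : a ∈ AddSubmonoid.closure (S : Set L) := by rw [hS]; trivial
    induction ha using AddSubmonoid.closure_induction with
    | mem x hx =>
      by_cases h0 : x = 0
      · exact ⟨0, by simp [φ, h0]⟩
      · refine ⟨Pi.single ⟨x, Finset.mem_erase.2 ⟨h0, hx⟩⟩ 1, ?_⟩
        simp only [φ]
        rw [Finset.sum_eq_single ⟨x, Finset.mem_erase.2 ⟨h0, hx⟩⟩]
        · simp
        · intro b _ hb
          simp [Pi.single_eq_of_ne hb]
        · simp
    | zero => exact ⟨0, by simp [φ]⟩
    | add x y _ _ hx hy =>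
      obtain ⟨n, rfl⟩ := hx
      obtain ⟨m, rfl⟩ := hy
      exact ⟨n + m, hadd n m⟩
  -- the fibre over `l` is an antichain, hence finite
  have hanti : IsAntichain (· ≤ ·) {n : T → ℕ | φ n = l} := by
    intro n hn m hm hne hle
    apply hne
    have hd : n + (m - n) = m := add_tsub_cancel_of_le hle
    have h1 : φ n + φ (m - n) = l := by rw [← hadd, hd]; exact hm
    have h2 : φ (m - n) = 0 := by
      apply IsPointedAffine.cancel _ _ (φ n)
      rw [zero_add, add_comm, h1]
      exact hn.symm
    rw [hzero _ h2, add_zero] at hd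
    exact hd
  have hfin : {n : T → ℕ | φ n = l}.Finite :=
    hanti.finite_of_partiallyWellOrderedOn (Set.isPWO_of_wellQuasiOrderedLE _)
  have hlow : (⋃ n ∈ {n : T → ℕ | φ n = l}, Set.Iic n).Finite :=
    hfin.biUnion fun n _ => Set.finite_Iic n
  refine ((hlow.prod hlow).image fun q => (φ q.1, φ q.2)).subset ?_
  rintro ⟨a, b⟩ hab
  obtain ⟨n, rfl⟩ := hsurj a
  obtain ⟨m, rfl⟩ := hsurj b
  have hab' : φ (n + m) = l := by rw [hadd]; exact hab
  refine ⟨(n, m), ⟨?_, ?_⟩, rfl⟩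
  · exact Set.mem_biUnion (x := n + m) hab' (Set.mem_Iic.2 le_self_add)
  · exact Set.mem_biUnion (x := n + m) hab' (Set.mem_Iic.2 le_add_self)

/-! ### Graded modules over the monoid algebra -/

/-- The translation category of `L`: its objects are the elements of `L`, and a morphism from `a`
to `b` is an element `m` of `L` with `a + m = b`. -/
structure Deg (L : Type v) : Type v where
  /-- the underlying element -/
  val : L

instance Deg.category (L : Type v) [AddCommMonoid L] : SmallCategory (Deg L) where
  Hom a b := {m : L // a.val + m = b.val}
  id a := ⟨0, add_zero _⟩
  comp f g := ⟨f.1 + g.1, by rw [← add_assoc, f.2, g.2]⟩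
  id_comp f := Subtype.ext (zero_add _)
  comp_id f := Subtype.ext (add_zero _)
  assoc f g h := Subtype.ext (add_assoc _ _ _)

/-- Multiplication by the monomial of `m`, from degree `a` to degree `a + m`. -/
def Deg.shift {L : Type v} [AddCommMonoid L] (a m : L) :
    (Deg.mk a : Deg L) ⟶ Deg.mk (a + m) := ⟨m, rfl⟩

/-- The category of `L`-graded modules over the monoid algebra `K[L]`. Such a module is a family
`M a` of `K`-modules indexed by the elements `a` of `L`, together with, for each monomial `x ^ m`
of `K[L]`, its action `M a → M (a + m)`, where `x ^ 0` acts as the identity and `x ^ (m + m')` as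
the composition of `x ^ m` and `x ^ m'`; that is, it is a functor on the translation category of
`L`. Morphisms are the homogeneous `K[L]`-linear maps of degree zero. -/
abbrev GrMod (K : Type u) [Field K] (L : Type v) [AddCommMonoid L] :=
  Deg L ⥤ ModuleCat.{max u v} K

/-- The field `K` as a graded module over `K[L]`: it is concentrated in degree zero, and all
nontrivial monomials act as zero. (In degree `a` it is the space of functions from the
truth value of `a = 0` to `K`, that is, `K` if `a = 0` and `0` otherwise.) -/
def residueField (K : Type u) [Field K] (L : Type v) [AddCommMonoid L] [IsPointedAffine L] :
    GrMod K L where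
  obj a := ModuleCat.of K (ULift.{v} (PLift (a.val = 0)) → K)
  map {a b} f := ModuleCat.ofHom (LinearMap.funLeft K K fun h : ULift.{v} (PLift (b.val = 0)) =>
    (⟨⟨(IsPointedAffine.pointed a.val f.1 (f.2.trans h.down.down)).1⟩⟩ :
      ULift.{v} (PLift (a.val = 0))))
  map_id _ := rfl
  map_comp _ _ := rfl

section Tensor

variable {K : Type u} [Field K] {L : Type v} [AddCommMonoid L]

/-- The pairs of degrees of total degree `l`. -/
abbrev DegPair (l : L) : Type v := {p : L × L // p.1 + p.2 = l}

/-- The degree `l` part of the tensor product over `K` of two graded modules. -/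
abbrev preTensor (M N : GrMod K L) (l : L) : Type max u v :=
  ⨁ p : DegPair l, (M.obj ⟨p.1.1⟩ ⊗[K] N.obj ⟨p.1.2⟩)

/-- The homogeneous element `x ⊗ y` of the tensor product over `K`. -/
noncomputable def preTensor.tmul {M N : GrMod K L} {l : L} (p : DegPair l)
    (x : M.obj ⟨p.1.1⟩) (y : N.obj ⟨p.1.2⟩) : preTensor M N l := by
  classical
  exact DirectSum.lof K (DegPair l) (fun p => (M.obj ⟨p.1.1⟩ ⊗[K] N.obj ⟨p.1.2⟩)) p (x ⊗ₜ[K] y)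

/-- The relations `(x ^ m • x) ⊗ y = x ⊗ (x ^ m • y)`, in degree `l`. -/
def tensorRelations (M N : GrMod K L) (l : L) : Submodule K (preTensor M N l) :=
  Submodule.span K {z | ∃ (a m b : L) (h : a + m + b = l) (x : M.obj ⟨a⟩) (y : N.obj ⟨b⟩),
    z = preTensor.tmul ⟨(a + m, b), h⟩ (M.map (Deg.shift a m) x) y -
      preTensor.tmul ⟨(a, b + m), by rw [← h, add_assoc, add_comm m b]⟩ x
        (N.map (Deg.shift b m) y)}

/-- The map `id ⊗ f` on the degree `l` part of the tensor product over `K`. -/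
noncomputable def preTensorMap (M : GrMod K L) {N N' : GrMod K L} (f : N ⟶ N') (l : L) :
    preTensor M N l →ₗ[K] preTensor M N' l :=
  DirectSum.lmap fun p => LinearMap.lTensor (M.obj ⟨p.1.1⟩) (f.app ⟨p.1.2⟩).hom

theorem preTensorMap_tmul (M : GrMod K L) {N N' : GrMod K L} (f : N ⟶ N') {l : L}
    (p : DegPair l) (x : M.obj ⟨p.1.1⟩) (y : N.obj ⟨p.1.2⟩) :
    preTensorMap M f l (preTensor.tmul p x y) = preTensor.tmul p x (f.app ⟨p.1.2⟩ y) := by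
  classical
  simp only [preTensorMap, preTensor.tmul]
  rw [DirectSum.lmap_lof]
  rfl

theorem preTensorMap_add (M : GrMod K L) {N N' : GrMod K L} (f g : N ⟶ N') (l : L) :
    preTensorMap M (f + g) l = preTensorMap M f l + preTensorMap M g l := by
  classical
  refine DirectSum.linearMap_ext _ fun p => TensorProduct.ext' fun x y => ?_
  change preTensorMap M (f + g) l (preTensor.tmul p x y) =
    preTensorMap M f l (preTensor.tmul p x y) + preTensorMap M g l (preTensor.tmul p x y)
  simp only [preTensorMap_tmul]
  simp [preTensor.tmul, TensorProduct.tmul_add]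

theorem tensorRelations_le (M : GrMod K L) {N N' : GrMod K L} (f : N ⟶ N') (l : L) :
    tensorRelations M N l ≤ (tensorRelations M N' l).comap (preTensorMap M f l) := by
  rw [tensorRelations, Submodule.span_le]
  rintro z ⟨a, m, b, h, x, y, rfl⟩
  refine Submodule.subset_span ⟨a, m, b, h, x, f.app ⟨b⟩ y, ?_⟩
  rw [map_sub, preTensorMap_tmul, preTensorMap_tmul]
  congr 2
  exact NatTrans.naturality_apply f (Deg.shift b m) y

/-- The functor sending a graded `K[L]`-module `N` to the degree `l` part of `M ⊗ N`, the tensor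
product over `K[L]`. -/
noncomputable def tensorDeg (M : GrMod K L) (l : L) : GrMod K L ⥤ ModuleCat.{max u v} K where
  obj N := ModuleCat.of K (preTensor M N l ⧸ tensorRelations M N l)
  map f := ModuleCat.ofHom (Submodule.mapQ _ _ (preTensorMap M f l) (tensorRelations_le M f l))
  map_id N := by
    classical
    ext : 1
    refine Submodule.linearMap_qext _ ?_
    refine DirectSum.linearMap_ext _ fun p => TensorProduct.ext' fun x y => ?_
    simp [preTensorMap]
  map_comp f g := by
    classical
    ext : 1
    refine Submodule.linearMap_qext _ ?_
    refine DirectSum.linearMap_ext _ fun p => TensorProduct.ext' fun x y => ?_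
    simp [preTensorMap, DirectSum.lmap_lof]

instance tensorDeg_additive (M : GrMod K L) (l : L) : (tensorDeg M l).Additive where
  map_add {N N' f g} := by
    ext : 1
    refine Submodule.linearMap_qext _ (LinearMap.ext fun z => ?_)
    change (tensorRelations M N' l).mkQ (preTensorMap M (f + g) l z) =
      (tensorRelations M N' l).mkQ (preTensorMap M f l z) +
        (tensorRelations M N' l).mkQ (preTensorMap M g l z)
    rw [preTensorMap_add]
    rfl

end Tensor

/-! ### Graded Tor -/

/-- Functor categories inherit enough projectives. -/
theorem functor_enoughProjectives (C : Type v) [SmallCategory C] (D : Type w) [Category.{u} D]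
    [HasColimitsOfSize.{v, v} D] [HasPullbacks D] [EnoughProjectives D] :
    EnoughProjectives (C ⥤ D) where
  presentation F := by
    have key : ∀ c : C, ∃ (P : C ⥤ D) (g : P ⟶ F), Projective P ∧ Epi (g.app c) := by
      intro c
      let adj := evaluationAdjunctionRight D c
      let g := (adj.homEquiv (Projective.over (F.obj c)) F).symm (Projective.π (F.obj c))
      have hg : adj.unit.app _ ≫ g.app c = Projective.π (F.obj c) := by
        have h := (adj.homEquiv (Projective.over (F.obj c)) F).apply_symm_apply
          (Projective.π (F.obj c))
        rwa [Adjunction.homEquiv_unit] at h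
      refine ⟨_, g, adj.map_projective _ inferInstance, ?_⟩
      have : Epi (adj.unit.app _ ≫ g.app c) := by rw [hg]; infer_instance
      exact epi_of_epi (adj.unit.app _) (g.app c)
    choose P g hP hg using key
    have hepi : Epi (Sigma.desc g) := by
      rw [NatTrans.epi_iff_epi_app]
      intro c
      have h : (Sigma.ι P c).app c ≫ (Sigma.desc g).app c = (g c).app c := by
        rw [← NatTrans.comp_app, Sigma.ι_desc]
      have : Epi ((Sigma.ι P c).app c ≫ (Sigma.desc g).app c) := by rw [h]; exact hg c
      exact epi_of_epi ((Sigma.ι P c).app c) ((Sigma.desc g).app c)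
    have hproj : Projective (∐ P) :=
      ⟨fun f e _ => ⟨Sigma.desc fun c => Projective.factorThru (Sigma.ι P c ≫ f) e, by
        refine Sigma.hom_ext _ _ fun c => ?_
        rw [Sigma.ι_desc_assoc, Projective.factorThru_comp]⟩⟩
    exact ⟨{ p := ∐ P, projective := hproj, f := Sigma.desc g, epi := hepi }⟩

instance GrMod.enoughProjectives (K : Type u) [Field K] (L : Type v) [AddCommMonoid L] :
    EnoughProjectives (GrMod K L) :=
  functor_enoughProjectives (Deg L) (ModuleCat.{max u v} K)

/-- `gradedTor M N i l` is the degree `l` part of the `L`-graded `K`-module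
`Tor_i^{K[L]}(M, N)`: the `i`-th left derived functor of `N ↦ (M ⊗ N)_l`. -/
noncomputable def gradedTor {K : Type u} [Field K] {L : Type v} [AddCommMonoid L]
    (M N : GrMod K L) (i : ℕ) (l : L) : ModuleCat.{max u v} K :=
  ((tensorDeg M l).leftDerived i).obj N

/-- The `K`-module `Tor_{i,l}^{K[L]}(K, K)`. -/
noncomputable abbrev residueTor (K : Type u) [Field K] {L : Type v} [AddCommMonoid L]
    [IsPointedAffine L] (i : ℕ) (l : L) : ModuleCat.{max u v} K :=
  gradedTor (residueField K L) (residueField K L) i l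

/-- The Betti number `β_i(l; L) = dim_K Tor_{i,l}^{K[L]}(K, K)`. -/
noncomputable def betti (K : Type u) [Field K] {L : Type v} [AddCommMonoid L]
    [IsPointedAffine L] (i : ℕ) (l : L) : ℕ :=
  Module.finrank K (residueTor K i l)

/-! ### Formal series and the Poincaré series -/

/-- Formal series `∑_l c_l z^l` over `l ∈ L` with coefficients `c_l` in the ring `ℤ⟦t⟧`. -/
@[ext]
structure FormalSeries (L : Type v) : Type v where
  /-- the coefficient of `z^l` -/
  coeff : L → PowerSeries ℤ

namespace FormalSeries

/-- The product of formal series, with `z^a * z^b = z^(a + b)`. -/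
noncomputable instance {L : Type v} [AddCommMonoid L] [IsPointedAffine L] :
    Mul (FormalSeries L) where
  mul F G := ⟨fun l => ∑ p ∈ (IsPointedAffine.finite_antidiagonal l).toFinset,
    F.coeff p.1 * G.coeff p.2⟩

open Classical in
/-- A formal series over `L₁`, seen as one over `L₁ ⊕ L₂` through `z^a = z^(a, 0)`. -/
noncomputable def inl {L₁ : Type v} (L₂ : Type w) [AddCommMonoid L₂] (F : FormalSeries L₁) :
    FormalSeries (L₁ × L₂) :=
  ⟨fun l => if l.2 = 0 then F.coeff l.1 else 0⟩

open Classical in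
/-- A formal series over `L₂`, seen as one over `L₁ ⊕ L₂` through `z^b = z^(0, b)`. -/
noncomputable def inr (L₁ : Type v) {L₂ : Type w} [AddCommMonoid L₁] (F : FormalSeries L₂) :
    FormalSeries (L₁ × L₂) :=
  ⟨fun l => if l.1 = 0 then F.coeff l.2 else 0⟩

end FormalSeries

/-- The Poincaré series `P_L(t, z) = ∑_l ∑_i β_i(l; L) t^i z^l`. -/
noncomputable def poincareSeries (K : Type u) [Field K] (L : Type v) [AddCommMonoid L]
    [IsPointedAffine L] : FormalSeries L :=
  ⟨fun l => PowerSeries.mk fun i => (betti K i l : ℤ)⟩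

/-!
The minimal resolution is not needed: any projective resolutions `P` and `Q` of the residue fields
over `K[L₁]` and `K[L₂]` will do, and the external tensor product `P ⊠ Q` resolves the residue field
over `K[L₁ ⊕ L₂]`.

* The external tensor product of free graded modules is free on the pairs of generators
  (`GrMod.extTensorFreeIso`), so the total complex of `P ⊠ Q` consists of projectives. In each
  degree `(a, b)` it is the tensor product of the complexes of vector spaces `P a` and `Q b`. The
  augmentations of these are homotopy equivalences, because over a field every resolution splits;
  hence so is the augmentation of the tensor product (`GrMod.quasiIso_mapBifunctorMap_extTensor`).
* The functor `(K ⊗ -)_l`, whose left derived functors are the graded Tor, is isomorphic to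
  `M ↦ (M / 𝔪 M)_l`, where `𝔪` is generated by the nontrivial monomials
  (`GrMod.tensorResidueIso`). A monomial over `L₁ ⊕ L₂` is nontrivial exactly when one of its two
  factors is, so `M ↦ M / 𝔪 M` takes external tensor products to tensor products of vector spaces
  (`GrMod.indecomposablesExtTensorIso`).
* Thus `Tor` over `K[L₁ ⊕ L₂]` in degree `(a, b)` is the homology of a tensor product of two
  complexes of vector spaces, whose homologies are `Tor` over `K[L₁]` in degree `a` and over `K[L₂]`
  in degree `b`. A complex over a field is homotopy equivalent to its homology, which gives the
  Künneth formula (`ModuleCat.finrank_homology_mapBifunctor_tensor`, `GrMod.betti_prod`).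

Finite-dimensionality comes from a resolution by locally finite free modules
(`GrMod.coverResolution_isLocallyFinite`), which exists because an element of an affine monoid has
only finitely many decompositions into two summands. In the product of the two Poincaré series,
only the decomposition `(a, b) = (a, 0) + (0, b)` contributes to the coefficient of `z ^ (a, b)`
(`FormalSeries.coeff_inl_mul_inr`), and the coefficient of `t ^ i` there is the Künneth sum.
-/

/-! ### Total complexes of bifunctors and additive functors -/

namespace HomologicalComplex

section MapBifunctor

variable {C₁ C₂ D : Type*} [Category* C₁] [Category* C₂] [Category* D]

instance finite_preimage_π_down (n : ℕ) : Finite (ComplexShape.π (ComplexShape.down ℕ)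
    (ComplexShape.down ℕ) (ComplexShape.down ℕ) ⁻¹' {n}) :=
  inferInstanceAs (Finite ((fun i : ℕ × ℕ => i.1 + i.2) ⁻¹' {n}))

/-- Total complexes of bounded below bicomplexes only involve finite coproducts. -/
instance hasMapBifunctor_down [HasZeroMorphisms C₁] [HasZeroMorphisms C₂] [Preadditive D]
    [HasFiniteCoproducts D] (K₁ : ChainComplex C₁ ℕ) (K₂ : ChainComplex C₂ ℕ) (F : C₁ ⥤ C₂ ⥤ D)
    [F.PreservesZeroMorphisms] [∀ X, (F.obj X).PreservesZeroMorphisms] :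
    HasMapBifunctor K₁ K₂ F (ComplexShape.down ℕ) := fun n => by
  infer_instance

section Homotopy

variable [Preadditive C₁] [Preadditive C₂] [Preadditive D] [HasFiniteCoproducts D]
  {K₁ L₁ M₁ : ChainComplex C₁ ℕ} {K₂ L₂ M₂ : ChainComplex C₂ ℕ}
  (F : C₁ ⥤ C₂ ⥤ D) [F.Additive] [∀ X, (F.obj X).Additive]

theorem mapBifunctorMap_comp (f₁ : K₁ ⟶ L₁) (g₁ : L₁ ⟶ M₁) (f₂ : K₂ ⟶ L₂) (g₂ : L₂ ⟶ M₂) :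
    mapBifunctorMap (f₁ ≫ g₁) (f₂ ≫ g₂) F (ComplexShape.down ℕ) =
      mapBifunctorMap f₁ f₂ F (ComplexShape.down ℕ) ≫
        mapBifunctorMap g₁ g₂ F (ComplexShape.down ℕ) := by
  ext n : 1
  refine mapBifunctor.hom_ext fun i j h => ?_
  rw [comp_f, ι_mapBifunctorMap, ι_mapBifunctorMap_assoc]
  simp only [Category.assoc, ι_mapBifunctorMap, comp_f, Functor.map_comp, NatTrans.comp_app]
  simp only [NatTrans.naturality_assoc]

theorem mapBifunctorMap_id :
    mapBifunctorMap (𝟙 K₁) (𝟙 K₂) F (ComplexShape.down ℕ) = 𝟙 _ := by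
  ext n : 1
  refine mapBifunctor.hom_ext fun i j h => ?_
  rw [ι_mapBifunctorMap, id_f, id_f, id_f, Category.comp_id, F.map_id]
  erw [(F.obj (K₁.X i)).map_id]
  rw [NatTrans.id_app, Category.id_comp]
  exact Category.id_comp _

/-- The homotopy equivalence of total complexes induced by two homotopy equivalences. -/
@[simps hom]
noncomputable def mapBifunctorHomotopyEquiv (e₁ : HomotopyEquiv K₁ L₁)
    (e₂ : HomotopyEquiv K₂ L₂) :
    HomotopyEquiv (mapBifunctor K₁ K₂ F (ComplexShape.down ℕ))
      (mapBifunctor L₁ L₂ F (ComplexShape.down ℕ)) where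
  hom := mapBifunctorMap e₁.hom e₂.hom F _
  inv := mapBifunctorMap e₁.inv e₂.inv F _
  homotopyHomInvId := ((Homotopy.ofEq (mapBifunctorMap_comp F _ _ _ _).symm).trans
    (mapBifunctorMapHomotopy₁ e₁.homotopyHomInvId _ F _)).trans
    ((mapBifunctorMapHomotopy₂ _ e₂.homotopyHomInvId F _).trans
      (Homotopy.ofEq (mapBifunctorMap_id F)))
  homotopyInvHomId := ((Homotopy.ofEq (mapBifunctorMap_comp F _ _ _ _).symm).trans
    (mapBifunctorMapHomotopy₁ e₁.homotopyInvHomId _ F _)).trans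
    ((mapBifunctorMapHomotopy₂ _ e₂.homotopyInvHomId F _).trans
      (Homotopy.ofEq (mapBifunctorMap_id F)))

end Homotopy

section Comparison

variable {C₁' C₂' D' : Type*} [Category* C₁'] [Category* C₂'] [Category* D']
  [Preadditive C₁] [Preadditive C₂] [Preadditive D] [HasFiniteCoproducts D]
  [Preadditive C₁'] [Preadditive C₂'] [Preadditive D'] [HasFiniteCoproducts D']
  {F : C₁ ⥤ C₂ ⥤ D} [F.Additive] [∀ X, (F.obj X).Additive]
  {F' : C₁' ⥤ C₂' ⥤ D'} [F'.Additive] [∀ X, (F'.obj X).Additive]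
  {G : D ⥤ D'} [G.Additive]
  {K₁ : ChainComplex C₁ ℕ} {K₂ : ChainComplex C₂ ℕ}
  {K₁' : ChainComplex C₁' ℕ} {K₂' : ChainComplex C₂' ℕ}

theorem ι_mapBifunctor_d (i j n m : ℕ) (h : i + j = n) :
    ιMapBifunctor K₁ K₂ F (ComplexShape.down ℕ) i j n h ≫
      (mapBifunctor K₁ K₂ F (ComplexShape.down ℕ)).d n m =
    mapBifunctor.d₁ K₁ K₂ F (ComplexShape.down ℕ) i j m +
      mapBifunctor.d₂ K₁ K₂ F (ComplexShape.down ℕ) i j m := by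
  rw [mapBifunctor.d_eq, Preadditive.comp_add, mapBifunctor.ι_D₁, mapBifunctor.ι_D₂]

section Map

variable (φ : ∀ i j, (F'.obj (K₁'.X i)).obj (K₂'.X j) ⟶ G.obj ((F.obj (K₁.X i)).obj (K₂.X j)))

/-- The component in a given degree of the morphism `mapBifunctorComparison`. -/
noncomputable def mapBifunctorComparisonX (n : ℕ) :
    (mapBifunctor K₁' K₂' F' (ComplexShape.down ℕ)).X n ⟶
      G.obj ((mapBifunctor K₁ K₂ F (ComplexShape.down ℕ)).X n) :=
  mapBifunctorDesc fun i j h =>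
    φ i j ≫ G.map (ιMapBifunctor K₁ K₂ F (ComplexShape.down ℕ) i j n h)

omit [G.Additive] in
theorem ι_mapBifunctorComparisonX (n i j : ℕ) (h : i + j = n) :
    ιMapBifunctor K₁' K₂' F' (ComplexShape.down ℕ) i j n h ≫ mapBifunctorComparisonX φ n =
      φ i j ≫ G.map (ιMapBifunctor K₁ K₂ F (ComplexShape.down ℕ) i j n h) :=
  ι_mapBifunctorDesc ..

omit [G.Additive] in
theorem ι_mapBifunctorComparisonX_assoc (n i j : ℕ) (h : i + j = n) {Z : D'}
    (f : G.obj ((mapBifunctor K₁ K₂ F (ComplexShape.down ℕ)).X n) ⟶ Z) :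
    ιMapBifunctor K₁' K₂' F' (ComplexShape.down ℕ) i j n h ≫ mapBifunctorComparisonX φ n ≫ f =
      φ i j ≫ G.map (ιMapBifunctor K₁ K₂ F (ComplexShape.down ℕ) i j n h) ≫ f := by
  rw [← Category.assoc, ι_mapBifunctorComparisonX φ n i j h, Category.assoc]

/-- A morphism from the bicomplex of the `F' (K₁' i, K₂' j)` to the image by `G` of the
bicomplex of the `F (K₁ i, K₂ j)` induces a morphism of total complexes. -/
noncomputable def mapBifunctorComparison
    (hφ₁ : ∀ i i' j, (F'.map (K₁'.d i i')).app (K₂'.X j) ≫ φ i' j =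
      φ i j ≫ G.map ((F.map (K₁.d i i')).app (K₂.X j)))
    (hφ₂ : ∀ i j j', (F'.obj (K₁'.X i)).map (K₂'.d j j') ≫ φ i j' =
      φ i j ≫ G.map ((F.obj (K₁.X i)).map (K₂.d j j'))) :
    mapBifunctor K₁' K₂' F' (ComplexShape.down ℕ) ⟶
      (G.mapHomologicalComplex _).obj (mapBifunctor K₁ K₂ F (ComplexShape.down ℕ)) where
  f n := mapBifunctorComparisonX φ n
  comm' n m hnm := by
    obtain rfl : m + 1 = n := hnm
    change mapBifunctorComparisonX φ (m + 1) ≫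
      G.map ((mapBifunctor K₁ K₂ F (ComplexShape.down ℕ)).d (m + 1) m) =
      (mapBifunctor K₁' K₂' F' (ComplexShape.down ℕ)).d (m + 1) m ≫ mapBifunctorComparisonX φ m
    refine mapBifunctor.hom_ext fun i j h => ?_
    rw [ι_mapBifunctorComparisonX_assoc _ _ _ _ h, ← G.map_comp, ι_mapBifunctor_d _ _ _ _ h,
      ← Category.assoc, ι_mapBifunctor_d _ _ _ _ h, G.map_add, Preadditive.comp_add,
      Preadditive.add_comp]
    congr 1
    · cases i with
      | zero =>
        rw [mapBifunctor.d₁_eq_zero _ _ _ _ _ _ _ (by simp),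
          mapBifunctor.d₁_eq_zero _ _ _ _ _ _ _ (by simp)]
        simp
      | succ i =>
        have hr : (ComplexShape.down ℕ).Rel (i + 1) i := rfl
        have hm : ComplexShape.π (ComplexShape.down ℕ) (ComplexShape.down ℕ)
            (ComplexShape.down ℕ) (i, j) = m := by
          have : i + 1 + j = m + 1 := h
          change i + j = m
          omega
        rw [mapBifunctor.d₁_eq _ _ _ _ hr _ _ hm, mapBifunctor.d₁_eq _ _ _ _ hr _ _ hm,
          Linear.units_smul_comp, Category.assoc, ι_mapBifunctorComparisonX _ _ _ _ hm,
          reassoc_of% (hφ₁ (i + 1) i j), Functor.map_units_smul, Linear.comp_units_smul,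
          G.map_comp]
    · cases j with
      | zero =>
        rw [mapBifunctor.d₂_eq_zero _ _ _ _ _ _ _ (by simp),
          mapBifunctor.d₂_eq_zero _ _ _ _ _ _ _ (by simp)]
        simp
      | succ j =>
        have hr : (ComplexShape.down ℕ).Rel (j + 1) j := rfl
        have hm : ComplexShape.π (ComplexShape.down ℕ) (ComplexShape.down ℕ)
            (ComplexShape.down ℕ) (i, j) = m := by
          have : i + (j + 1) = m + 1 := h
          change i + j = m
          omega
        rw [mapBifunctor.d₂_eq _ _ _ _ _ hr _ hm, mapBifunctor.d₂_eq _ _ _ _ _ hr _ hm,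
          Linear.units_smul_comp, Category.assoc, ι_mapBifunctorComparisonX _ _ _ _ hm,
          reassoc_of% (hφ₂ i (j + 1) j), Functor.map_units_smul, Linear.comp_units_smul,
          G.map_comp]

end Map

variable [PreservesFiniteCoproducts G]
  (φ : ∀ i j, (F'.obj (K₁'.X i)).obj (K₂'.X j) ≅ G.obj ((F.obj (K₁.X i)).obj (K₂.X j)))

omit [G.Additive] in
/-- As `G` preserves finite coproducts, it commutes with total complexes in every degree. -/
theorem isIso_mapBifunctorComparisonX (n : ℕ) :
    IsIso (mapBifunctorComparisonX (fun i j => (φ i j).hom) n) := by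
  -- `G` preserves the coproduct which defines the target, so the inverse `ψ` can be defined on
  -- the images by `G` of its summands
  let hc := isColimitOfPreserves G (GradedObject.isColimitCofanMapObj
    (((F.mapBifunctorHomologicalComplex _ _).obj K₁).obj K₂).toGradedObject
    (ComplexShape.π (ComplexShape.down ℕ) (ComplexShape.down ℕ) (ComplexShape.down ℕ)) n)
  let s : Cocone (Discrete.functor (GradedObject.mapObjFun
      (((F.mapBifunctorHomologicalComplex (ComplexShape.down ℕ) (ComplexShape.down ℕ)).obj K₁).obj
        K₂).toGradedObject (ComplexShape.π (ComplexShape.down ℕ) (ComplexShape.down ℕ)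
          (ComplexShape.down ℕ)) n) ⋙ G) :=
    ⟨(mapBifunctor K₁' K₂' F' (ComplexShape.down ℕ)).X n, Discrete.natTrans fun p =>
      (φ p.as.1.1 p.as.1.2).inv ≫
        ιMapBifunctor K₁' K₂' F' (ComplexShape.down ℕ) p.as.1.1 p.as.1.2 n p.as.2⟩
  have hu {f : G.obj ((mapBifunctor K₁ K₂ F (ComplexShape.down ℕ)).X n) ⟶
      G.obj ((mapBifunctor K₁ K₂ F (ComplexShape.down ℕ)).X n)}
      (hf : ∀ i j (h : i + j = n),
        G.map (ιMapBifunctor K₁ K₂ F (ComplexShape.down ℕ) i j n h) ≫ f =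
          G.map (ιMapBifunctor K₁ K₂ F (ComplexShape.down ℕ) i j n h)) : f = 𝟙 _ :=
    hc.hom_ext fun p => (hf p.as.1.1 p.as.1.2 p.as.2).trans (Category.comp_id _).symm
  obtain ⟨ψ, hψ⟩ : ∃ ψ : G.obj ((mapBifunctor K₁ K₂ F (ComplexShape.down ℕ)).X n) ⟶
      (mapBifunctor K₁' K₂' F' (ComplexShape.down ℕ)).X n, ∀ i j (h : i + j = n),
      G.map (ιMapBifunctor K₁ K₂ F (ComplexShape.down ℕ) i j n h) ≫ ψ =
        (φ i j).inv ≫ ιMapBifunctor K₁' K₂' F' (ComplexShape.down ℕ) i j n h :=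
    ⟨hc.desc s, fun i j h => hc.fac s ⟨⟨(i, j), h⟩⟩⟩
  refine ⟨ψ, mapBifunctor.hom_ext fun i j h => ?_, hu fun i j h => ?_⟩
  · rw [ι_mapBifunctorComparisonX_assoc _ _ _ _ h, hψ _ _ h, Iso.hom_inv_id_assoc,
      Category.comp_id]
  · rw [reassoc_of% (hψ i j h), ι_mapBifunctorComparisonX _ _ _ _ h, Iso.inv_hom_id_assoc]

/-- An additive functor which preserves finite coproducts commutes with the formation of total
complexes. -/
theorem isIso_mapBifunctorComparison (hφ₁ hφ₂) :
    IsIso (mapBifunctorComparison (fun i j => (φ i j).hom) hφ₁ hφ₂) := by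
  have (n : ℕ) : IsIso ((mapBifunctorComparison (fun i j => (φ i j).hom) hφ₁ hφ₂).f n) :=
    isIso_mapBifunctorComparisonX φ n
  exact Hom.isIso_of_components _

end Comparison

end MapBifunctor

end HomologicalComplex

/-! ### The Künneth formula over a field -/

namespace ChainComplex

open HomologicalComplex

section Split

variable {C : Type*} [Category* C] [Abelian C]

/-- The homology of a chain complex, as a complex with zero differentials. -/
noncomputable def homologyComplex (A : ChainComplex C ℕ) : ChainComplex C ℕ where
  X n := A.homology n
  d _ _ := 0

theorem homologyComplex_d (A : ChainComplex C ℕ) (i j : ℕ) : (homologyComplex A).d i j = 0 := rfl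

/-- If every morphism has a generalized inverse, for example in a category of vector spaces, then
every chain complex is homotopy equivalent to its homology. -/
theorem nonempty_homotopyEquiv_homologyComplex
    (hC : ∀ {X Y : C} (f : X ⟶ Y), ∃ g : Y ⟶ X, f ≫ g ≫ f = f) (A : ChainComplex C ℕ) :
    Nonempty (HomotopyEquiv A (homologyComplex A)) := by
  -- `r` is a retraction of the inclusion of the cycles
  have hr (n : ℕ) : ∃ r : A.X n ⟶ A.cycles n, A.iCycles n ≫ r = 𝟙 _ := by
    obtain ⟨r, hr⟩ := hC (A.iCycles n)
    exact ⟨r, by rw [← cancel_mono (A.iCycles n), Category.assoc, hr, Category.id_comp]⟩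
  choose r hr using hr
  -- `g` is a generalized inverse of the differential, seen as a map to the cycles
  choose g hg using fun n => hC (A.toCycles (n + 1) n)
  -- `s` is the section of the projection to the homology whose image is complementary to the
  -- boundaries in the sense of `g`
  have hs (n : ℕ) : ∃ s : A.homology n ⟶ A.cycles n,
      A.homologyπ n ≫ s = 𝟙 _ - g n ≫ A.toCycles (n + 1) n := by
    have h0 : A.toCycles (n + 1) n ≫ (𝟙 _ - g n ≫ A.toCycles (n + 1) n) = 0 := by
      rw [Preadditive.comp_sub, Category.comp_id, hg, sub_self]
    have hl := A.homologyIsCokernel (n + 1) n (by simp)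
    exact ⟨hl.desc (CokernelCofork.ofπ _ h0), hl.fac _ WalkingParallelPair.one⟩
  choose s hs using hs
  have hsπ (n : ℕ) : s n ≫ A.homologyπ n = 𝟙 _ := by
    rw [← cancel_epi (A.homologyπ n), ← Category.assoc, hs, Preadditive.sub_comp, Category.assoc,
      A.toCycles_comp_homologyπ, comp_zero, sub_zero, Category.id_comp, Category.comp_id]
  let K (n : ℕ) : A.X n ⟶ A.X (n + 1) := r n ≫ g n ≫ (𝟙 _ - r (n + 1) ≫ A.iCycles (n + 1))
  have hKd (n : ℕ) : K n ≫ A.d (n + 1) n =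
      r n ≫ A.iCycles n - r n ≫ A.homologyπ n ≫ s n ≫ A.iCycles n := by
    have : (𝟙 _ - r (n + 1) ≫ A.iCycles (n + 1)) ≫ A.d (n + 1) n = A.d (n + 1) n := by
      rw [Preadditive.sub_comp, Category.assoc, A.iCycles_d, comp_zero, sub_zero, Category.id_comp]
    simp only [K, Category.assoc, this]
    rw [reassoc_of% (hs n), Preadditive.sub_comp, Preadditive.comp_sub, Category.id_comp,
      sub_sub_cancel, Category.assoc, A.toCycles_i]
  have hdK (n : ℕ) : A.d (n + 1) n ≫ K n = 𝟙 _ - r (n + 1) ≫ A.iCycles (n + 1) := by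
    have h0 : (A.toCycles (n + 1) n ≫ g n - 𝟙 _) ≫ A.d (n + 1) n = 0 := by
      rw [← A.toCycles_i, ← Category.assoc, Preadditive.sub_comp, Category.assoc, hg,
        Category.id_comp, sub_self, zero_comp]
    have h1 : (A.toCycles (n + 1) n ≫ g n - 𝟙 _) ≫ (𝟙 _ - r (n + 1) ≫ A.iCycles (n + 1)) = 0 := by
      rw [← A.liftCycles_i _ n (by simp) h0, Category.assoc, Preadditive.comp_sub,
        Category.comp_id, ← Category.assoc (A.iCycles _), hr, Category.id_comp, sub_self,
        comp_zero]
    rw [Preadditive.sub_comp, Category.id_comp, sub_eq_zero, Category.assoc] at h1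
    refine Eq.trans ?_ h1
    simp only [K]
    rw [← A.toCycles_i (n + 1) n, Category.assoc, ← Category.assoc (A.iCycles n), hr,
      Category.id_comp]
  let f : A ⟶ homologyComplex A :=
    { f n := r n ≫ A.homologyπ n
      comm' n m hnm := by
        obtain rfl : m + 1 = n := hnm
        refine comp_zero.trans ?_
        change 0 = A.d (m + 1) m ≫ r m ≫ A.homologyπ m
        rw [← A.toCycles_i (m + 1) m, Category.assoc,
          ← Category.assoc (A.iCycles m), hr, Category.id_comp, A.toCycles_comp_homologyπ] }
  let k : homologyComplex A ⟶ A :=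
    { f n := s n ≫ A.iCycles n
      comm' n m _ := by
        refine Eq.trans ?_ zero_comp.symm
        change (s n ≫ A.iCycles n) ≫ A.d n m = 0
        rw [Category.assoc, A.iCycles_d, comp_zero] }
  have hkf : k ≫ f = 𝟙 _ := by
    ext n
    change (s n ≫ A.iCycles n) ≫ r n ≫ A.homologyπ n = 𝟙 _
    rw [Category.assoc, ← Category.assoc (A.iCycles n), hr, Category.id_comp, hsπ]
  let hom (i j : ℕ) : A.X i ⟶ A.X j :=
    if h : i + 1 = j then K i ≫ eqToHom (congrArg A.X h) else 0
  have hhom (i : ℕ) : hom i (i + 1) = K i := by simp [hom]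
  have H : Homotopy (𝟙 A) (f ≫ k) :=
    { hom := hom
      zero i j hij := dif_neg hij
      comm n := by
        change 𝟙 _ = _ + (r n ≫ A.homologyπ n) ≫ s n ≫ A.iCycles n
        rw [Homotopy.prevD_chainComplex, hhom, hKd, Category.assoc]
        cases n with
        | zero =>
          have : IsIso (A.iCycles 0) := A.isIso_iCycles 0 _ rfl (A.shape _ _ (by simp))
          have : r 0 ≫ A.iCycles 0 = 𝟙 _ := by
            rw [← cancel_epi (A.iCycles 0), ← Category.assoc, hr, Category.id_comp,
              Category.comp_id]
          rw [Homotopy.dNext_zero_chainComplex, this]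
          abel
        | succ n =>
          rw [Homotopy.dNext_succ_chainComplex, hhom, hdK]
          abel }
  exact ⟨⟨f, k, H.symm, Homotopy.ofEq hkf⟩⟩

end Split

end ChainComplex

namespace ModuleCat

variable (K : Type u) [Field K]

/-- Over a field, the tensor product of modules in possibly different universes, as a bifunctor. -/
@[simps]
noncomputable def tensorBifunctor :
    ModuleCat.{v} K ⥤ ModuleCat.{w} K ⥤ ModuleCat.{max v w} K where
  obj V :=
    { obj W := ModuleCat.of K (V ⊗[K] W)
      map g := ModuleCat.ofHom (LinearMap.lTensor V g.hom)
      map_id W := by ext : 1; exact LinearMap.lTensor_id _ _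
      map_comp g h := by ext : 1; exact LinearMap.lTensor_comp _ _ _ }
  map f :=
    { app W := ModuleCat.ofHom (LinearMap.rTensor W f.hom)
      naturality W W' g := by
        ext : 1
        exact (LinearMap.rTensor_comp_lTensor ..).trans (LinearMap.lTensor_comp_rTensor ..).symm }
  map_id V := by ext W : 3; exact LinearMap.rTensor_id _ _
  map_comp f g := by ext W : 3; exact LinearMap.rTensor_comp _ _ _

instance : (tensorBifunctor.{u, v, w} K).Additive where
  map_add := by intros; ext W : 3; exact LinearMap.rTensor_add _ _ _

instance (V : ModuleCat.{v} K) : ((tensorBifunctor.{u, v, w} K).obj V).Additive where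
  map_add := by intros; ext : 1; exact LinearMap.lTensor_add _ _ _

variable {K}

/-- Linear maps between vector spaces have generalized inverses. -/
theorem exists_generalizedInverse {V W : ModuleCat.{v} K} (f : V ⟶ W) :
    ∃ g : W ⟶ V, f ≫ g ≫ f = f := by
  obtain ⟨s, hs⟩ := f.hom.rangeRestrict.exists_rightInverse_of_surjective f.hom.range_rangeRestrict
  obtain ⟨g, hg⟩ := LinearMap.exists_extend s
  refine ⟨ofHom g, ?_⟩
  ext x
  have h1 : g (f.hom x) = s (f.hom.rangeRestrict x) := LinearMap.congr_fun hg (f.hom.rangeRestrict x)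
  change f.hom (g (f.hom x)) = f.hom x
  rw [h1]
  exact congrArg Subtype.val (LinearMap.congr_fun hs (f.hom.rangeRestrict x))

open HomologicalComplex ChainComplex

/-- The dimensions of the components of the tensor product of two complexes of vector spaces. -/
theorem finrank_mapBifunctor_tensor_X (A : ChainComplex (ModuleCat.{v} K) ℕ)
    (B : ChainComplex (ModuleCat.{w} K) ℕ) [∀ n, Module.Finite K (A.X n)]
    [∀ n, Module.Finite K (B.X n)] (n : ℕ) :
    Module.Finite K ((mapBifunctor A B (tensorBifunctor K) (ComplexShape.down ℕ)).X n) ∧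
    Module.finrank K ((mapBifunctor A B (tensorBifunctor K) (ComplexShape.down ℕ)).X n) =
      ∑ p ∈ Finset.HasAntidiagonal.antidiagonal n,
        Module.finrank K (A.X p.1) * Module.finrank K (B.X p.2) := by
  classical
  let S : Set (ℕ × ℕ) := ComplexShape.π (ComplexShape.down ℕ) (ComplexShape.down ℕ)
    (ComplexShape.down ℕ) ⁻¹' {n}
  let : Fintype S := Fintype.ofFinite S
  let Z (p : S) : ModuleCat.{max v w} K := ModuleCat.of K (A.X p.1.1 ⊗[K] B.X p.1.2)
  let e : (mapBifunctor A B (tensorBifunctor K) (ComplexShape.down ℕ)).X n ≃ₗ[K] ⨁ p, Z p :=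
    (coprodIsoDirectSum Z).toLinearEquiv
  have (p : S) : Module.Finite K (Z p) :=
    inferInstanceAs (Module.Finite K (A.X p.1.1 ⊗[K] B.X p.1.2))
  refine ⟨Module.Finite.equiv e.symm, ?_⟩
  rw [e.finrank_eq, Module.finrank_directSum,
    Finset.sum_subtype (p := (· ∈ S)) (Finset.HasAntidiagonal.antidiagonal n)
      (fun x => Finset.HasAntidiagonal.mem_antidiagonal)]
  exact Finset.sum_congr rfl fun p _ => Module.finrank_tensorProduct

/-- The Künneth formula for dimensions. -/
theorem finrank_homology_mapBifunctor_tensor (A : ChainComplex (ModuleCat.{v} K) ℕ)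
    (B : ChainComplex (ModuleCat.{w} K) ℕ) [∀ n, Module.Finite K (A.homology n)]
    [∀ n, Module.Finite K (B.homology n)] (n : ℕ) :
    Module.Finite K ((mapBifunctor A B (tensorBifunctor K) (ComplexShape.down ℕ)).homology n) ∧
    Module.finrank K ((mapBifunctor A B (tensorBifunctor K) (ComplexShape.down ℕ)).homology n) =
      ∑ p ∈ Finset.HasAntidiagonal.antidiagonal n,
        Module.finrank K (A.homology p.1) * Module.finrank K (B.homology p.2) := by
  obtain ⟨eA⟩ := nonempty_homotopyEquiv_homologyComplex exists_generalizedInverse A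
  obtain ⟨eB⟩ := nonempty_homotopyEquiv_homologyComplex exists_generalizedInverse B
  -- up to homotopy, both complexes may be replaced by their homology, with zero differentials
  let T := mapBifunctor (homologyComplex A) (homologyComplex B) (tensorBifunctor K)
    (ComplexShape.down ℕ)
  have hT (i j : ℕ) : T.d i j = 0 := by
    refine mapBifunctor.hom_ext fun p q h => ?_
    rw [ι_mapBifunctor_d _ _ _ _ h, comp_zero]
    have h1 : mapBifunctor.d₁ (homologyComplex A) (homologyComplex B) (tensorBifunctor K)
        (ComplexShape.down ℕ) p q j = 0 := by
      by_cases hp : (ComplexShape.down ℕ).Rel p ((ComplexShape.down ℕ).next p)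
      · rw [mapBifunctor.d₁_eq' _ _ _ _ hp, homologyComplex_d, Functor.map_zero, zero_app,
          zero_comp, smul_zero]
      · exact mapBifunctor.d₁_eq_zero _ _ _ _ _ _ _ hp
    have h2 : mapBifunctor.d₂ (homologyComplex A) (homologyComplex B) (tensorBifunctor K)
        (ComplexShape.down ℕ) p q j = 0 := by
      by_cases hq : (ComplexShape.down ℕ).Rel q ((ComplexShape.down ℕ).next q)
      · rw [mapBifunctor.d₂_eq' _ _ _ _ _ hq, homologyComplex_d, Functor.map_zero,
          zero_comp, smul_zero]
      · exact mapBifunctor.d₂_eq_zero _ _ _ _ _ _ _ hq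
    rw [h1, h2, add_zero]
  let e : (mapBifunctor A B (tensorBifunctor K) (ComplexShape.down ℕ)).homology n ≅ T.X n :=
    (mapBifunctorHomotopyEquiv (tensorBifunctor K) eA eB).toHomologyIso n ≪≫
      (ShortComplex.HomologyData.ofZeros (T.sc n) (hT _ _) (hT _ _)).left.homologyIso
  have (m : ℕ) : Module.Finite K ((homologyComplex A).X m) :=
    inferInstanceAs (Module.Finite K (A.homology m))
  have (m : ℕ) : Module.Finite K ((homologyComplex B).X m) :=
    inferInstanceAs (Module.Finite K (B.homology m))
  obtain ⟨h1, h2⟩ := finrank_mapBifunctor_tensor_X (homologyComplex A) (homologyComplex B) n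
  exact ⟨Module.Finite.equiv e.toLinearEquiv.symm, e.toLinearEquiv.finrank_eq.trans h2⟩

end ModuleCat

/-! ### External tensor products, free graded modules and resolutions -/

namespace GrMod

section ExternalTensor

variable {K : Type u} [Field K] {L₁ : Type v} [AddCommMonoid L₁] {L₂ : Type w} [AddCommMonoid L₂]

variable (L₁ L₂) in
/-- The projection to the first factor on translation categories. -/
@[simps]
def degFst : Deg (L₁ × L₂) ⥤ Deg L₁ where
  obj a := ⟨a.val.1⟩
  map f := ⟨f.1.1, congrArg Prod.fst f.2⟩

variable (L₁ L₂) in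
/-- The projection to the second factor on translation categories. -/
@[simps]
def degSnd : Deg (L₁ × L₂) ⥤ Deg L₂ where
  obj a := ⟨a.val.2⟩
  map f := ⟨f.1.2, congrArg Prod.snd f.2⟩

/-- The external tensor product of a graded `K[L₁]`-module and a graded `K[L₂]`-module: the graded
`K[L₁ ⊕ L₂]`-module which is `M a ⊗ N b` in degree `(a, b)`. -/
noncomputable def extTensorObj (M : GrMod K L₁) (N : GrMod K L₂) : GrMod K (L₁ × L₂) where
  obj a := ModuleCat.of K (M.obj ((degFst L₁ L₂).obj a) ⊗[K] N.obj ((degSnd L₁ L₂).obj a))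
  map f := ModuleCat.ofHom
    (TensorProduct.map (M.map ((degFst L₁ L₂).map f)).hom (N.map ((degSnd L₁ L₂).map f)).hom)
  map_id a := by
    ext : 1
    simp only [CategoryTheory.Functor.map_id]
    exact TensorProduct.map_id
  map_comp f g := by
    ext : 1
    simp only [CategoryTheory.Functor.map_comp]
    exact TensorProduct.map_comp ..

/-- The external tensor product as a bifunctor. -/
noncomputable def extTensor : GrMod K L₁ ⥤ GrMod K L₂ ⥤ GrMod K (L₁ × L₂) where
  obj M :=
    { obj N := extTensorObj M N
      map {N N'} g :=
        { app a := ModuleCat.ofHom (LinearMap.lTensor _ (g.app ((degSnd L₁ L₂).obj a)).hom)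
          naturality a b f := by
            ext : 1
            refine TensorProduct.ext' fun x y => ?_
            exact congrArg (M.map ((degFst L₁ L₂).map f) x ⊗ₜ[K] ·)
              (NatTrans.naturality_apply g ((degSnd L₁ L₂).map f) y) }
      map_id N := by
        ext a : 3
        exact LinearMap.lTensor_id _ _
      map_comp g h := by
        ext a : 3
        exact LinearMap.lTensor_comp _ _ _ }
  map {M M'} g :=
    { app N :=
        { app a := ModuleCat.ofHom (LinearMap.rTensor _ (g.app ((degFst L₁ L₂).obj a)).hom)
          naturality a b f := by
            ext : 1
            refine TensorProduct.ext' fun x y => ?_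
            exact congrArg (· ⊗ₜ[K] N.map ((degSnd L₁ L₂).map f) y)
              (NatTrans.naturality_apply g ((degFst L₁ L₂).map f) x) }
      naturality N N' h := by
        ext a : 3
        exact (LinearMap.rTensor_comp_lTensor ..).trans (LinearMap.lTensor_comp_rTensor ..).symm }
  map_id M := by
    ext N a : 5
    exact LinearMap.rTensor_id _ _
  map_comp g h := by
    ext N a : 5
    exact LinearMap.rTensor_comp _ _ _

instance : (extTensor (K := K) (L₁ := L₁) (L₂ := L₂)).Additive where
  map_add := by
    intros
    ext N a : 5
    exact LinearMap.rTensor_add _ _ _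

instance (M : GrMod K L₁) : ((extTensor (L₂ := L₂)).obj M).Additive where
  map_add := by
    intros
    ext a : 3
    exact LinearMap.lTensor_add _ _ _

end ExternalTensor

section Free

variable (K : Type u) [Field K] {L : Type v} [AddCommMonoid L]

/-- The free graded module on a family of homogeneous generators of degrees `deg b`. In degree `l`
it has a basis consisting of the pairs of a generator and a monomial of total degree `l`. -/
noncomputable def free {B : Type max u v} (deg : B → L) : GrMod K L where
  obj l := ModuleCat.of K ({p : B × L // deg p.1 + p.2 = l.val} →₀ K)
  map {l l'} f := ModuleCat.ofHom (Finsupp.lmapDomain K K fun p =>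
    ⟨(p.1.1, p.1.2 + f.1), by rw [← add_assoc, p.2, f.2]⟩)
  map_id l := by
    ext : 1
    refine Eq.trans ?_ (Finsupp.lmapDomain_id K K)
    refine congrArg (Finsupp.lmapDomain K K) (funext fun p => ?_)
    exact Subtype.ext (Prod.ext rfl (add_zero _))
  map_comp f g := by
    ext : 1
    refine Eq.trans ?_ (Finsupp.lmapDomain_comp K K _ _)
    refine congrArg (Finsupp.lmapDomain K K) (funext fun p => ?_)
    exact Subtype.ext (Prod.ext rfl (add_assoc _ _ _).symm)

variable {K}
variable {B : Type max u v} {deg : B → L}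

/-- The basis element of a free graded module given by a generator `b` and the monomial of `m`. -/
noncomputable def free.single (b : B) (m : L) {l : L} (h : deg b + m = l) :
    (free K deg).obj ⟨l⟩ :=
  Finsupp.single (⟨(b, m), h⟩ : {p : B × L // deg p.1 + p.2 = l}) (1 : K)

theorem free.map_single (b : B) (m m' : L) {l l' : L} (h : deg b + m = l) (h' : l + m' = l') :
    (free K deg).map (⟨m', h'⟩ : (⟨l⟩ : Deg L) ⟶ ⟨l'⟩) (free.single b m h) =
      free.single b (m + m') (by rw [← add_assoc, h, h']) :=
  Finsupp.mapDomain_single ..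

theorem free.linearMap_ext {l : L} {V : Type*} [AddCommGroup V] [Module K V]
    {f g : (free K deg).obj ⟨l⟩ →ₗ[K] V}
    (h : ∀ b m (h : deg b + m = l), f (free.single b m h) = g (free.single b m h)) : f = g :=
  Finsupp.lhom_ext' fun p => LinearMap.ext_ring (h p.1.1 p.1.2 p.2)

/-- The degree `l` component of `free.lift`. -/
noncomputable def free.liftApp {M : GrMod K L} (x : ∀ b, M.obj ⟨deg b⟩) (l : Deg L) :
    (free K deg).obj l →ₗ[K] M.obj l :=
  Finsupp.linearCombination K fun p : {p : B × L // deg p.1 + p.2 = l.val} =>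
    M.map (⟨p.1.2, p.2⟩ : (⟨deg p.1.1⟩ : Deg L) ⟶ l) (x p.1.1)

theorem free.liftApp_single {M : GrMod K L} (x : ∀ b, M.obj ⟨deg b⟩) (b : B) (m : L) {l : Deg L}
    (h : deg b + m = l.val) : free.liftApp x l (free.single b m h) =
      M.map (⟨m, h⟩ : (⟨deg b⟩ : Deg L) ⟶ l) (x b) :=
  (Finsupp.linearCombination_single ..).trans (one_smul _ _)

/-- The morphism from a free graded module given by the images of the generators. -/
noncomputable def free.lift {M : GrMod K L} (x : ∀ b, M.obj ⟨deg b⟩) : free K deg ⟶ M where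
  app l := ModuleCat.ofHom (free.liftApp x l)
  naturality l l' f := by
    ext : 1
    refine free.linearMap_ext fun b m h => ?_
    refine (congrArg (free.liftApp x l') (free.map_single b m f.1 h f.2)).trans ?_
    refine Eq.trans ?_ (congrArg (M.map f) (free.liftApp_single x b m h)).symm
    rw [free.liftApp_single]
    exact ConcreteCategory.congr_hom (M.map_comp (⟨m, h⟩ : (⟨deg b⟩ : Deg L) ⟶ l) f) (x b)

theorem free.lift_single {M : GrMod K L} (x : ∀ b, M.obj ⟨deg b⟩) (b : B) (m : L) {l : L}
    (h : deg b + m = l) : (free.lift x).app ⟨l⟩ (free.single b m h) =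
      M.map (⟨m, h⟩ : (⟨deg b⟩ : Deg L) ⟶ ⟨l⟩) (x b) :=
  free.liftApp_single x b m h

/-- Morphisms from a free graded module are determined by the images of the generators. -/
theorem free.hom_ext {M : GrMod K L} {f g : free K deg ⟶ M}
    (h : ∀ b, f.app ⟨deg b⟩ (free.single b 0 (add_zero _)) =
      g.app ⟨deg b⟩ (free.single b 0 (add_zero _))) : f = g := by
  have key (f : free K deg ⟶ M) (b : B) (m l : L) (hl : deg b + m = l) :
      f.app ⟨l⟩ (free.single b m hl) =
        M.map (⟨m, hl⟩ : (⟨deg b⟩ : Deg L) ⟶ ⟨l⟩)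
          (f.app ⟨deg b⟩ (free.single b 0 (add_zero _))) := by
    rw [← NatTrans.naturality_apply, free.map_single]
    simp only [zero_add]
  ext l : 3
  refine free.linearMap_ext fun b m hl => ?_
  refine (key f b m _ hl).trans (Eq.trans ?_ (key g b m _ hl).symm)
  rw [h]

theorem epi_iff_surjective {M N : GrMod K L} (f : M ⟶ N) :
    Epi f ↔ ∀ l, Function.Surjective (f.app l) := by
  rw [NatTrans.epi_iff_epi_app]
  exact forall_congr' fun l => ModuleCat.epi_iff_surjective _

instance free.projective : Projective (free K deg) where
  factors {E X} f e he := by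
    rw [epi_iff_surjective] at he
    choose y hy using fun b => he _ (f.app ⟨deg b⟩ (free.single b 0 (add_zero _)))
    refine ⟨free.lift y, free.hom_ext fun b => ?_⟩
    refine Eq.trans ?_ (hy b)
    refine congrArg (e.app _) ((free.lift_single y b 0 (add_zero _)).trans ?_)
    exact ConcreteCategory.congr_hom (E.map_id ⟨deg b⟩) (y b)

/-- The generators of the free graded module covering `M`: bases of all the components of `M`. -/
abbrev CoverIndex (M : GrMod K L) : Type max u v :=
  Σ a : L, Module.Free.ChooseBasisIndex K (M.obj ⟨a⟩)

/-- A free graded module covering `M`. -/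
noncomputable def cover (M : GrMod K L) : GrMod K L :=
  free K (fun b : CoverIndex M => b.1)

/-- The projection from the free graded module covering `M`. -/
noncomputable def coverπ (M : GrMod K L) : cover M ⟶ M :=
  free.lift fun b => Module.Free.chooseBasis K (M.obj ⟨b.1⟩) b.2

instance (M : GrMod K L) : Projective (cover M) := free.projective

instance (M : GrMod K L) : Epi (coverπ M) := by
  rw [epi_iff_surjective]
  rintro ⟨l⟩
  refine LinearMap.range_eq_top.1 (top_le_iff.1 ?_)
  rw [← (Module.Free.chooseBasis K (M.obj ⟨l⟩)).span_eq, Submodule.span_le]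
  rintro _ ⟨i, rfl⟩
  refine ⟨free.single ⟨l, i⟩ 0 (add_zero _), (free.lift_single ..).trans ?_⟩
  exact ConcreteCategory.congr_hom (M.map_id ⟨l⟩) _

/-- A graded module all of whose components are finite-dimensional. -/
def IsLocallyFinite (M : GrMod K L) : Prop :=
  ∀ l, Module.Finite K (M.obj l)

theorem IsLocallyFinite.of_mono {M N : GrMod K L} (hN : IsLocallyFinite N) (f : M ⟶ N) [Mono f] :
    IsLocallyFinite M := fun l => by
  have := hN l
  exact Module.Finite.of_injective (f.app l).hom
    ((ModuleCat.mono_iff_injective _).1 ((NatTrans.mono_iff_mono_app f).1 inferInstance l))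

/-- The component of degree `l` of the cover involves only the decompositions `l = a + m` into the
degrees of a generator and of a monomial, of which an affine monoid has only finitely many. -/
theorem IsLocallyFinite.cover [IsPointedAffine L] {M : GrMod K L} (hM : IsLocallyFinite M) :
    IsLocallyFinite (cover M) := by
  rintro ⟨l⟩
  have (a : L) : Finite (Module.Free.ChooseBasisIndex K (M.obj ⟨a⟩)) := by
    have := hM ⟨a⟩
    infer_instance
  have : Finite (DegPair l) := IsPointedAffine.finite_antidiagonal l
  have : Finite {p : CoverIndex M × L // p.1.1 + p.2 = l} :=
    Finite.of_injective
      (fun p => (⟨⟨(p.1.1.1, p.1.2), p.2⟩, p.1.1.2⟩ :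
        Σ q : DegPair l, Module.Free.ChooseBasisIndex K (M.obj ⟨q.1.1⟩)))
      (by
        rintro ⟨⟨⟨a, i⟩, m⟩, h⟩ ⟨⟨⟨a', i'⟩, m'⟩, h'⟩ e
        simp only [Sigma.mk.injEq, Subtype.mk.injEq, Prod.mk.injEq] at e
        obtain ⟨⟨rfl, rfl⟩, e⟩ := e
        obtain rfl := eq_of_heq e
        rfl)
  exact inferInstanceAs
    (Module.Finite K ({p : CoverIndex M × L // p.1.1 + p.2 = l} →₀ K))

theorem IsLocallyFinite.kernel {M N : GrMod K L} (hM : IsLocallyFinite M) (f : M ⟶ N) :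
    IsLocallyFinite (kernel f) :=
  hM.of_mono (kernel.ι f)

end Free

section Projective

variable {K : Type u} [Field K] {L₁ : Type v} [AddCommMonoid L₁] {L₂ : Type w} [AddCommMonoid L₂]

section

variable {B₁ : Type max u v} (deg₁ : B₁ → L₁) {B₂ : Type max u w} (deg₂ : B₂ → L₂)

/-- A pair of basis elements of two free modules is a basis element of the free module on the
pairs of generators. -/
def freePairEquiv (a : L₁ × L₂) :
    {p : B₁ × L₁ // deg₁ p.1 + p.2 = a.1} × {p : B₂ × L₂ // deg₂ p.1 + p.2 = a.2} ≃
      {p : (B₁ × B₂) × (L₁ × L₂) // (deg₁ p.1.1, deg₂ p.1.2) + p.2 = a} where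
  toFun p := ⟨((p.1.1.1, p.2.1.1), (p.1.1.2, p.2.1.2)), Prod.ext p.1.2 p.2.2⟩
  invFun p := (⟨(p.1.1.1, p.1.2.1), congrArg Prod.fst p.2⟩,
    ⟨(p.1.1.2, p.1.2.2), congrArg Prod.snd p.2⟩)
  left_inv _ := rfl
  right_inv _ := rfl

/-- The components of `extTensorFreeIso`. -/
noncomputable def extTensorFreeEquiv (a : Deg (L₁ × L₂)) :
    ((extTensor.obj (free K deg₁)).obj (free K deg₂)).obj a ≃ₗ[K]
      (free K (fun b : B₁ × B₂ => (deg₁ b.1, deg₂ b.2))).obj a :=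
  (finsuppTensorFinsupp' K _ _).trans (Finsupp.domLCongr (freePairEquiv deg₁ deg₂ a.val))

theorem extTensorFreeEquiv_single (b₁ : B₁) (m₁ : L₁) (b₂ : B₂) (m₂ : L₂) {a : Deg (L₁ × L₂)}
    (h₁ : deg₁ b₁ + m₁ = a.val.1) (h₂ : deg₂ b₂ + m₂ = a.val.2) :
    extTensorFreeEquiv (K := K) deg₁ deg₂ a
      (free.single b₁ m₁ h₁ ⊗ₜ[K] free.single b₂ m₂ h₂) =
    free.single (b₁, b₂) (m₁, m₂) (Prod.ext h₁ h₂) := by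
  refine (congrArg (Finsupp.domLCongr (R := K) (M := K) (freePairEquiv deg₁ deg₂ a.val))
    (finsuppTensorFinsupp'_single_tmul_single ..)).trans ?_
  rw [one_mul]
  exact Finsupp.domLCongr_single ..

/-- The external tensor product of two free graded modules is free. -/
noncomputable def extTensorFreeIso : (extTensor.obj (free K deg₁)).obj (free K deg₂) ≅
    free K (fun b : B₁ × B₂ => (deg₁ b.1, deg₂ b.2)) :=
  NatIso.ofComponents (fun a => (extTensorFreeEquiv deg₁ deg₂ a).toModuleIso) fun {a b} f => by
    ext : 1
    refine TensorProduct.ext (free.linearMap_ext fun b₁ m₁ h₁ =>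
      free.linearMap_ext fun b₂ m₂ h₂ => ?_)
    change extTensorFreeEquiv deg₁ deg₂ b
        ((free K deg₁).map ((degFst L₁ L₂).map f) (free.single b₁ m₁ h₁) ⊗ₜ[K]
          (free K deg₂).map ((degSnd L₁ L₂).map f) (free.single b₂ m₂ h₂)) =
      (free K _).map f (extTensorFreeEquiv deg₁ deg₂ a
        (free.single b₁ m₁ h₁ ⊗ₜ[K] free.single b₂ m₂ h₂))
    rw [extTensorFreeEquiv_single]
    have e₁ : (free K deg₁).map ((degFst L₁ L₂).map f) (free.single b₁ m₁ h₁) = _ :=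
      free.map_single b₁ m₁ f.1.1 h₁ (congrArg Prod.fst f.2)
    have e₂ : (free K deg₂).map ((degSnd L₁ L₂).map f) (free.single b₂ m₂ h₂) = _ :=
      free.map_single b₂ m₂ f.1.2 h₂ (congrArg Prod.snd f.2)
    rw [e₁, e₂]
    refine (extTensorFreeEquiv_single deg₁ deg₂ b₁ (m₁ + f.1.1) b₂ (m₂ + f.1.2) _ _).trans ?_
    exact (free.map_single (b₁, b₂) (m₁, m₂) f.1 (Prod.ext h₁ h₂) f.2).symm

end

theorem nonempty_retract_cover (M : GrMod K L₁) [Projective M] :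
    Nonempty (Retract M (cover M)) :=
  ⟨Projective.factorThru (𝟙 M) (coverπ M), coverπ M, Projective.factorThru_comp _ _⟩

/-- A projective graded module is a retract of a free one, so the free case suffices. -/
instance extTensor_projective (M : GrMod K L₁) (N : GrMod K L₂) [Projective M] [Projective N] :
    Projective ((extTensor.obj M).obj N) := by
  obtain ⟨r₁⟩ := nonempty_retract_cover M
  obtain ⟨r₂⟩ := nonempty_retract_cover N
  have : Projective ((extTensor.obj (cover M)).obj (cover N)) :=
    Projective.of_iso (extTensorFreeIso _ _).symm free.projective
  have : Projective ((extTensor.obj (cover M)).obj N) := (r₂.map (extTensor.obj _)).projective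
  exact Retract.projective (p := this) ((r₁.map extTensor).map ((evaluation _ _).obj N))

end Projective

section Resolution

variable {K : Type u} [Field K] {L : Type v} [AddCommMonoid L]

/-- A cover of the kernel of `f`, mapping to the source of `f`. -/
noncomputable def coverKernel {M N : GrMod K L} (f : M ⟶ N) : cover (kernel f) ⟶ M :=
  coverπ (kernel f) ≫ kernel.ι f

theorem coverKernel_comp {M N : GrMod K L} (f : M ⟶ N) : coverKernel f ≫ f = 0 := by
  rw [coverKernel, Category.assoc, kernel.condition, comp_zero]

theorem exact_coverKernel {M N : GrMod K L} (f : M ⟶ N) :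
    (ShortComplex.mk (coverKernel f) f (coverKernel_comp f)).Exact := by
  let α : ShortComplex.mk (coverKernel f) f (coverKernel_comp f) ⟶
      ShortComplex.mk (kernel.ι f) f (kernel.condition f) :=
    { τ₁ := coverπ _
      τ₂ := 𝟙 _
      τ₃ := 𝟙 _ }
  have : Epi α.τ₁ := inferInstanceAs (Epi (coverπ (kernel f)))
  have : IsIso α.τ₂ := inferInstanceAs (IsIso (𝟙 _))
  have : Mono α.τ₃ := inferInstanceAs (Mono (𝟙 _))
  rw [ShortComplex.exact_iff_of_epi_of_isIso_of_mono α]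
  exact ShortComplex.exact_of_f_is_kernel _ (kernelIsKernel f)

/-- Iterated covers of kernels, starting from the projection of the cover of `M`. -/
noncomputable def coverSeq (M : GrMod K L) : ℕ → Arrow (GrMod K L)
  | 0 => Arrow.mk (coverπ M)
  | n + 1 => Arrow.mk (coverKernel (coverSeq M n).hom)

/-- The complex of free graded modules obtained from `M` by iterated covers of kernels. -/
noncomputable def coverComplex (M : GrMod K L) : ChainComplex (GrMod K L) ℕ :=
  ChainComplex.of (fun n => (coverSeq M n).left) (fun n => coverKernel (coverSeq M n).hom)
    fun n => coverKernel_comp (coverKernel (coverSeq M n).hom)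

theorem coverComplex_d (M : GrMod K L) (n : ℕ) :
    (coverComplex M).d (n + 1) n = coverKernel (coverSeq M n).hom :=
  ChainComplex.of_d (fun n => (coverSeq M n).left) (fun n => coverKernel (coverSeq M n).hom) n

theorem coverComplex_d_comp_coverπ (M : GrMod K L) : (coverComplex M).d 1 0 ≫ coverπ M = 0 := by
  rw [coverComplex_d]
  exact coverKernel_comp (coverπ M)

theorem coverComplex_exactAt_succ (M : GrMod K L) (n : ℕ) :
    (coverComplex M).ExactAt (n + 1) := by
  rw [HomologicalComplex.exactAt_iff' _ (n + 1 + 1) (n + 1) n (by simp) (by simp)]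
  refine ShortComplex.exact_of_iso ?_ (exact_coverKernel (coverSeq M (n + 1)).hom)
  exact ShortComplex.isoMk (Iso.refl _) (Iso.refl _) (Iso.refl _)
    ((Category.id_comp _).trans ((coverComplex_d M (n + 1)).trans (Category.comp_id _).symm))
    ((Category.id_comp _).trans ((coverComplex_d M n).trans (Category.comp_id _).symm))

/-- The projective resolution of `M` by iterated covers of kernels. -/
noncomputable def coverResolution (M : GrMod K L) : ProjectiveResolution M where
  complex := coverComplex M
  projective n := by
    cases n with
    | zero => exact inferInstanceAs (Projective (cover M))
    | succ n => exact inferInstanceAs (Projective (cover (kernel (coverSeq M n).hom)))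
  π := (ChainComplex.toSingle₀Equiv _ _).symm ⟨coverπ M, coverComplex_d_comp_coverπ M⟩
  quasiIso := ⟨fun n => by
    cases n with
    | zero =>
      rw [ChainComplex.quasiIsoAt₀_iff, ShortComplex.quasiIso_iff_of_zeros']
      · refine (ShortComplex.exact_and_epi_g_iff_of_iso ?_).2
          ⟨exact_coverKernel (coverπ M), inferInstanceAs (Epi (coverπ M))⟩
        exact ShortComplex.isoMk (Iso.refl _) (Iso.refl _) (Iso.refl _)
          ((Category.id_comp _).trans ((coverComplex_d M 0).symm.trans (Category.comp_id _).symm))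
          (by
            refine (Category.id_comp _).trans (Eq.trans ?_ (Category.comp_id _).symm)
            exact (ChainComplex.toSingle₀Equiv_symm_apply_f_zero (C := coverComplex M) (X := M)
              (coverπ M) (coverComplex_d_comp_coverπ M)).symm)
      all_goals rfl
    | succ n =>
      rw [quasiIsoAt_iff_exactAt']
      · exact coverComplex_exactAt_succ M n
      · exact ChainComplex.exactAt_succ_single_obj ..⟩

theorem coverResolution_isLocallyFinite [IsPointedAffine L] {M : GrMod K L}
    (hM : IsLocallyFinite M) (n : ℕ) :
    IsLocallyFinite ((coverResolution M).complex.X n) := by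
  change IsLocallyFinite (coverSeq M n).left
  cases n with
  | zero => exact hM.cover
  | succ n =>
    induction n with
    | zero => exact (hM.cover.kernel (coverπ M)).cover
    | succ n ih => exact (ih.kernel (coverSeq M (n + 1)).hom).cover

end Resolution

end GrMod

/-! ### Tensoring with the residue field -/

namespace GrMod

section Indecomposables

variable {K : Type u} [Field K] {L : Type v} [AddCommMonoid L]

theorem map_map (M : GrMod K L) {a b c m m' : L} (h : a + m = b) (h' : b + m' = c)
    (x : M.obj ⟨a⟩) : M.map (⟨m', h'⟩ : (⟨b⟩ : Deg L) ⟶ ⟨c⟩)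
      (M.map (⟨m, h⟩ : (⟨a⟩ : Deg L) ⟶ ⟨b⟩) x) =
    M.map (⟨m + m', by rw [← add_assoc, h, h']⟩ : (⟨a⟩ : Deg L) ⟶ ⟨c⟩) x :=
  (ConcreteCategory.congr_hom (M.map_comp (⟨m, h⟩ : (⟨a⟩ : Deg L) ⟶ ⟨b⟩)
    (⟨m', h'⟩ : (⟨b⟩ : Deg L) ⟶ ⟨c⟩)) x).symm

theorem map_zero_apply (M : GrMod K L) {a : L} (h : a + 0 = a) (x : M.obj ⟨a⟩) :
    M.map (⟨0, h⟩ : (⟨a⟩ : Deg L) ⟶ ⟨a⟩) x = x :=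
  ConcreteCategory.congr_hom (M.map_id ⟨a⟩) x

/-- The elements of degree `l` of the submodule `𝔪 M`, where `𝔪` is the ideal of `K[L]` generated
by the nontrivial monomials. -/
def decomposables (M : GrMod K L) (l : L) : Submodule K (M.obj ⟨l⟩) :=
  Submodule.span K {z | ∃ (b m : L) (h : b + m = l) (_ : m ≠ 0) (y : M.obj ⟨b⟩),
    z = M.map (⟨m, h⟩ : (⟨b⟩ : Deg L) ⟶ ⟨l⟩) y}

theorem map_mem_decomposables (M : GrMod K L) {b m l : L} (h : b + m = l) (hm : m ≠ 0)
    (y : M.obj ⟨b⟩) : M.map (⟨m, h⟩ : (⟨b⟩ : Deg L) ⟶ ⟨l⟩) y ∈ decomposables M l :=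
  Submodule.subset_span ⟨b, m, h, hm, y, rfl⟩

theorem decomposables_le_comap {M N : GrMod K L} (f : M ⟶ N) (l : L) :
    decomposables M l ≤ (decomposables N l).comap (f.app ⟨l⟩).hom := by
  rw [decomposables, Submodule.span_le]
  rintro _ ⟨b, m, h, hm, y, rfl⟩
  have : (f.app ⟨l⟩).hom (M.map (⟨m, h⟩ : (⟨b⟩ : Deg L) ⟶ ⟨l⟩) y) = _ :=
    NatTrans.naturality_apply f (⟨m, h⟩ : (⟨b⟩ : Deg L) ⟶ ⟨l⟩) y
  rw [SetLike.mem_coe, Submodule.mem_comap, this]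
  exact map_mem_decomposables N h hm _

variable (K) in
/-- The functor sending `M` to the degree `l` part of `M / 𝔪 M`. -/
noncomputable def indecomposables (l : L) : GrMod K L ⥤ ModuleCat.{max u v} K where
  obj M := ModuleCat.of K (M.obj ⟨l⟩ ⧸ decomposables M l)
  map f := ModuleCat.ofHom (Submodule.mapQ _ _ (f.app ⟨l⟩).hom (decomposables_le_comap f l))
  map_id M := by
    ext : 1
    exact Submodule.linearMap_qext _ rfl
  map_comp f g := by
    ext : 1
    exact Submodule.linearMap_qext _ rfl

instance (l : L) : (indecomposables K l).Additive where
  map_add {M N f g} := by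
    ext : 1
    exact Submodule.linearMap_qext _ rfl

end Indecomposables

section Comparison

variable {K : Type u} [Field K] {L : Type v} [AddCommMonoid L]

/-- The homogeneous element `x ⊗ y` of the tensor product over `K`, as a linear map in `y`. -/
noncomputable def tmulRight (M : GrMod K L) {N : GrMod K L} {l : L} (p : DegPair l)
    (x : M.obj ⟨p.1.1⟩) : N.obj ⟨p.1.2⟩ →ₗ[K] preTensor M N l where
  toFun y := preTensor.tmul p x y
  map_add' y y' := by simp [preTensor.tmul, TensorProduct.tmul_add]
  map_smul' c y := by simp [preTensor.tmul]

theorem tmul_smul_left {M N : GrMod K L} {l : L} (p : DegPair l) (c : K)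
    (x : M.obj ⟨p.1.1⟩) (y : N.obj ⟨p.1.2⟩) :
    preTensor.tmul p (c • x) y = c • preTensor.tmul p x y := by
  rw [preTensor.tmul, ← TensorProduct.smul_tmul', map_smul]
  rfl

/-- The relation `(x ^ m • x) ⊗ y = x ⊗ (x ^ m • y)`, for arbitrary names of the degrees. -/
theorem mk_tmul_map_eq {M N : GrMod K L} {a m a' b b' l : L} (ha : a + m = a') (hb : b + m = b')
    (h : a' + b = l) (h' : a + b' = l) (x : M.obj ⟨a⟩) (y : N.obj ⟨b⟩) :
    (tensorRelations M N l).mkQ (preTensor.tmul ⟨(a', b), h⟩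
        (M.map (⟨m, ha⟩ : (⟨a⟩ : Deg L) ⟶ ⟨a'⟩) x) y) =
      (tensorRelations M N l).mkQ (preTensor.tmul ⟨(a, b'), h'⟩ x
        (N.map (⟨m, hb⟩ : (⟨b⟩ : Deg L) ⟶ ⟨b'⟩) y)) := by
  subst ha hb
  exact (Submodule.Quotient.eq _).2 (Submodule.subset_span ⟨a, m, b, h, x, y, rfl⟩)

theorem tensor_linearMap_ext {M N : GrMod K L} {l : L} {V : Type*} [AddCommGroup V] [Module K V]
    {f g : (preTensor M N l ⧸ tensorRelations M N l) →ₗ[K] V}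
    (h : ∀ (a b : L) (h : a + b = l) (x : M.obj ⟨a⟩) (y : N.obj ⟨b⟩),
      f ((tensorRelations M N l).mkQ (preTensor.tmul ⟨(a, b), h⟩ x y)) =
        g ((tensorRelations M N l).mkQ (preTensor.tmul ⟨(a, b), h⟩ x y))) : f = g := by
  classical
  refine Submodule.linearMap_qext _ (DirectSum.linearMap_ext _ fun p =>
    TensorProduct.ext' fun x y => ?_)
  exact h p.1.1 p.1.2 p.2 x y

variable [IsPointedAffine L]

theorem residueField_subsingleton {a : L} (h : a ≠ 0) :
    Subsingleton ((residueField K L).obj ⟨a⟩) :=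
  ⟨fun _ _ => funext fun x => absurd x.down.down h⟩

/-- The residue field vanishes off degree zero. -/
theorem tmul_eq_zero_of_ne (M : GrMod K L) {a b l : L} (h : a + b = l) (ha : a ≠ 0)
    (x : (residueField K L).obj ⟨a⟩) (y : M.obj ⟨b⟩) : preTensor.tmul ⟨(a, b), h⟩ x y = 0 := by
  have := residueField_subsingleton (K := K) ha
  rw [Subsingleton.elim x 0, ← zero_smul K 0, tmul_smul_left, zero_smul]

open Classical in
/-- The map from `⨁ K_a ⊗ M_b` to `M_l / (𝔪 M)_l` which underlies `tensorResidueHom`. -/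
noncomputable def preTensorResidueHom (M : GrMod K L) (l : L) :
    preTensor (residueField K L) M l →ₗ[K] M.obj ⟨l⟩ ⧸ decomposables M l :=
  DirectSum.toModule K (DegPair l) _ fun p =>
    if h : p.1.1 = 0 then
      TensorProduct.lift ((LinearMap.lsmul K (M.obj ⟨l⟩ ⧸ decomposables M l)).compl₁₂
        (LinearMap.proj ⟨⟨h⟩⟩ : (ULift.{v} (PLift (p.1.1 = 0)) → K) →ₗ[K] K)
        ((decomposables M l).mkQ ∘ₗ
          (M.map (⟨p.1.1, (add_comm _ _).trans p.2⟩ : (⟨p.1.2⟩ : Deg L) ⟶ ⟨l⟩)).hom))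
    else 0

theorem preTensorResidueHom_tmul_of_eq (M : GrMod K L) {a b l : L} (h : a + b = l) (ha : a = 0)
    (x : (residueField K L).obj ⟨a⟩) (y : M.obj ⟨b⟩) :
    preTensorResidueHom M l (preTensor.tmul ⟨(a, b), h⟩ x y) =
      (x ⟨⟨ha⟩⟩ : K) • (decomposables M l).mkQ
        (M.map (⟨a, (add_comm _ _).trans h⟩ : (⟨b⟩ : Deg L) ⟶ ⟨l⟩) y) := by
  classical
  refine (DirectSum.toModule_lof ..).trans ?_
  rw [dif_pos ha]
  rfl

theorem preTensorResidueHom_tmul_of_ne (M : GrMod K L) {a b l : L} (h : a + b = l) (ha : a ≠ 0)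
    (x : (residueField K L).obj ⟨a⟩) (y : M.obj ⟨b⟩) :
    preTensorResidueHom M l (preTensor.tmul ⟨(a, b), h⟩ x y) = 0 := by
  classical
  refine (DirectSum.toModule_lof ..).trans ?_
  rw [dif_neg ha]
  rfl

/-- The map `x ⊗ y ↦ x • [y]` respects the relations: a nontrivial monomial kills both sides. -/
theorem tensorRelations_le_ker (M : GrMod K L) (l : L) :
    tensorRelations (residueField K L) M l ≤ LinearMap.ker (preTensorResidueHom M l) := by
  rw [tensorRelations, Submodule.span_le]
  rintro _ ⟨a, m, b, h, x, y, rfl⟩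
  rw [SetLike.mem_coe, LinearMap.mem_ker, map_sub, sub_eq_zero]
  by_cases ha : a = 0
  · subst ha
    rw [preTensorResidueHom_tmul_of_eq M _ rfl]
    by_cases hm : m = 0
    · subst hm
      rw [preTensorResidueHom_tmul_of_eq M _ (add_zero 0)]
      refine congrArg₂ (· • ·) rfl (congrArg _ ?_)
      refine Eq.trans ?_ (map_map M ..).symm
      rfl
    · rw [preTensorResidueHom_tmul_of_ne M _ (by rwa [zero_add])]
      refine Eq.symm (smul_eq_zero_of_right _ ((Submodule.Quotient.mk_eq_zero _).2 ?_))
      rw [Deg.shift, map_map]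
      exact map_mem_decomposables M _ (by rwa [add_zero]) y
  · rw [preTensorResidueHom_tmul_of_ne M _ ha, preTensorResidueHom_tmul_of_ne M _
      fun h0 => ha (IsPointedAffine.pointed _ _ h0).1]

/-- The map `y ↦ 1 ⊗ y` on the degree `l` part of `M`. -/
noncomputable def oneTmul (M : GrMod K L) (l : L) :
    M.obj ⟨l⟩ →ₗ[K] preTensor (residueField K L) M l :=
  tmulRight (residueField K L) ⟨(0, l), zero_add l⟩ fun _ => 1

/-- A tensor `x ⊗ y` with `x` of degree `a = 0` is a multiple of `1 ⊗ y`. As `a` is a variable, `x`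
is first moved to degree `0` by means of the trivial monomial. -/
theorem mk_oneTmul (M : GrMod K L) {a b l : L} (h : a + b = l)
    (x : (residueField K L).obj ⟨a⟩) (ha : a = 0) (y : M.obj ⟨b⟩) :
    (tensorRelations (residueField K L) M l).mkQ (preTensor.tmul ⟨(a, b), h⟩ x y) =
      (x ⟨⟨ha⟩⟩ : K) • (tensorRelations (residueField K L) M l).mkQ (oneTmul M l
        (M.map (⟨a, (add_comm _ _).trans h⟩ : (⟨b⟩ : Deg L) ⟶ ⟨l⟩) y)) := by
  let x₀ : (residueField K L).obj ⟨0⟩ := (x ⟨⟨ha⟩⟩ : K) • fun _ => (1 : K)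
  have hx : x = (residueField K L).map (⟨a, zero_add a⟩ : (⟨0⟩ : Deg L) ⟶ ⟨a⟩) x₀ :=
    funext fun _ => (mul_one _).symm
  rw [← map_smul]
  refine Eq.trans ?_ (congrArg _ (tmul_smul_left _ _ _ _))
  refine Eq.trans ?_ (mk_tmul_map_eq (zero_add a) ((add_comm _ _).trans h) h (zero_add l) x₀ y)
  rw [← hx]

/-- A nontrivial monomial acts as zero on the residue field, so `1 ⊗ -` kills its image. -/
theorem decomposables_le_ker (M : GrMod K L) (l : L) :
    decomposables M l ≤ LinearMap.ker
      ((tensorRelations (residueField K L) M l).mkQ ∘ₗ oneTmul M l) := by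
  rw [decomposables, Submodule.span_le]
  rintro _ ⟨b, m, h, hm, y, rfl⟩
  refine (mk_tmul_map_eq (zero_add m) h ((add_comm _ _).trans h) (zero_add l) _ y).symm.trans ?_
  exact (congrArg _ (tmul_eq_zero_of_ne M _ hm _ _)).trans (map_zero _)

/-- The isomorphism `(K ⊗ M)_l ≅ (M / 𝔪 M)_l`. -/
noncomputable def tensorResidueEquiv (M : GrMod K L) (l : L) :
    (preTensor (residueField K L) M l ⧸ tensorRelations (residueField K L) M l) ≃ₗ[K]
      (M.obj ⟨l⟩ ⧸ decomposables M l) :=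
  LinearEquiv.ofLinearMap
    (Submodule.liftQ _ (preTensorResidueHom M l) (tensorRelations_le_ker M l))
    (Submodule.liftQ _ _ (decomposables_le_ker M l))
    (Submodule.linearMap_qext _ (LinearMap.ext fun y => by
      refine (preTensorResidueHom_tmul_of_eq M (zero_add l) rfl _ y).trans ?_
      rw [one_smul, map_zero_apply]
      rfl))
    (tensor_linearMap_ext fun a b h x y => by
      by_cases ha : a = 0
      · rw [mk_oneTmul M h x ha, map_smul, map_smul]
        refine congrArg _ ?_
        refine (congrArg (Submodule.liftQ _ _ (decomposables_le_ker M l))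
          (preTensorResidueHom_tmul_of_eq M (zero_add l) rfl _ _)).trans ?_
        rw [one_smul, map_zero_apply]
        rfl
      · rw [tmul_eq_zero_of_ne M h ha, map_zero, map_zero, map_zero])

/-- Tensoring with the residue field is the same as reducing modulo `𝔪`. -/
noncomputable def tensorResidueIso (l : L) :
    tensorDeg (residueField K L) l ≅ indecomposables K l :=
  NatIso.ofComponents (fun M => (tensorResidueEquiv M l).toModuleIso) fun {M N} f => by
    ext : 1
    refine tensor_linearMap_ext fun a b h x y => ?_
    change preTensorResidueHom N l (preTensorMap _ f l (preTensor.tmul ⟨(a, b), h⟩ x y)) =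
      Submodule.mapQ _ _ (f.app ⟨l⟩).hom (decomposables_le_comap f l)
        (preTensorResidueHom M l (preTensor.tmul ⟨(a, b), h⟩ x y))
    rw [preTensorMap_tmul]
    by_cases ha : a = 0
    · rw [preTensorResidueHom_tmul_of_eq M h ha, preTensorResidueHom_tmul_of_eq N h ha, map_smul]
      refine congrArg _ (congrArg (decomposables N l).mkQ ?_)
      exact (NatTrans.naturality_apply f (⟨a, (add_comm _ _).trans h⟩ : (⟨b⟩ : Deg L) ⟶ ⟨l⟩) y).symm
    · rw [preTensorResidueHom_tmul_of_ne M h ha, preTensorResidueHom_tmul_of_ne N h ha, map_zero]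

end Comparison

end GrMod

/-! ### Indecomposables and residue fields of external tensor products -/

namespace GrMod

variable {K : Type u} [Field K] {L₁ : Type v} [AddCommMonoid L₁] {L₂ : Type w} [AddCommMonoid L₂]

section Indecomposables

/-- The decomposable elements of an external tensor product in degree `l`, as a submodule of
`M_{l.1} ⊗ N_{l.2}`. -/
noncomputable def extDecomposables (M : GrMod K L₁) (N : GrMod K L₂) (l : L₁ × L₂) :
    Submodule K (M.obj ⟨l.1⟩ ⊗[K] N.obj ⟨l.2⟩) :=
  decomposables ((extTensor.obj M).obj N) l

theorem map_tmul_map_mem_extDecomposables (M : GrMod K L₁) (N : GrMod K L₂) {b m l : L₁ × L₂}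
    (h₁ : b.1 + m.1 = l.1) (h₂ : b.2 + m.2 = l.2) (hm : m ≠ 0) (x : M.obj ⟨b.1⟩)
    (y : N.obj ⟨b.2⟩) :
    M.map (⟨m.1, h₁⟩ : (⟨b.1⟩ : Deg L₁) ⟶ ⟨l.1⟩) x ⊗ₜ[K]
      N.map (⟨m.2, h₂⟩ : (⟨b.2⟩ : Deg L₂) ⟶ ⟨l.2⟩) y ∈ extDecomposables M N l :=
  map_mem_decomposables ((extTensor.obj M).obj N) (Prod.ext h₁ h₂ : b + m = l) hm (x ⊗ₜ[K] y)

theorem extDecomposables_le {M : GrMod K L₁} {N : GrMod K L₂} {l : L₁ × L₂}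
    {S : Submodule K (M.obj ⟨l.1⟩ ⊗[K] N.obj ⟨l.2⟩)}
    (h : ∀ (b m : L₁ × L₂) (h₁ : b.1 + m.1 = l.1) (h₂ : b.2 + m.2 = l.2) (_ : m ≠ 0)
      (x : M.obj ⟨b.1⟩) (y : N.obj ⟨b.2⟩),
      M.map (⟨m.1, h₁⟩ : (⟨b.1⟩ : Deg L₁) ⟶ ⟨l.1⟩) x ⊗ₜ[K]
        N.map (⟨m.2, h₂⟩ : (⟨b.2⟩ : Deg L₂) ⟶ ⟨l.2⟩) y ∈ S) :
    extDecomposables M N l ≤ S := by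
  refine Submodule.span_le.2 ?_
  rintro _ ⟨b, m, hl, hm, z, rfl⟩
  have h₁ : b.1 + m.1 = l.1 := congrArg Prod.fst hl
  have h₂ : b.2 + m.2 = l.2 := congrArg Prod.snd hl
  suffices hS : ∀ z : M.obj ⟨b.1⟩ ⊗[K] N.obj ⟨b.2⟩,
      TensorProduct.map (M.map (⟨m.1, h₁⟩ : (⟨b.1⟩ : Deg L₁) ⟶ ⟨l.1⟩)).hom
        (N.map (⟨m.2, h₂⟩ : (⟨b.2⟩ : Deg L₂) ⟶ ⟨l.2⟩)).hom z ∈ S from hS z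
  intro z
  induction z using TensorProduct.induction_on with
  | zero => rw [map_zero]; exact zero_mem S
  | tmul x y => exact h b m h₁ h₂ hm x y
  | add z z' hz hz' => rw [map_add]; exact add_mem hz hz'

/-- A nontrivial monomial over `L₁ ⊕ L₂` is nontrivial in one of the two factors. -/
theorem extDecomposables_eq (M : GrMod K L₁) (N : GrMod K L₂) (l : L₁ × L₂) :
    extDecomposables M N l =
      LinearMap.range (TensorProduct.map (decomposables M l.1).subtype LinearMap.id) ⊔
        LinearMap.range (TensorProduct.map LinearMap.id (decomposables N l.2).subtype) := by
  apply le_antisymm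
  · refine extDecomposables_le fun b m h₁ h₂ hm x y => ?_
    by_cases hm₁ : m.1 = 0
    · have hm₂ : m.2 ≠ 0 := fun hm₂ => hm (Prod.ext hm₁ hm₂)
      exact Submodule.mem_sup_right
        ⟨_ ⊗ₜ ⟨_, map_mem_decomposables N h₂ hm₂ y⟩, TensorProduct.map_tmul ..⟩
    · exact Submodule.mem_sup_left
        ⟨⟨_, map_mem_decomposables M h₁ hm₁ x⟩ ⊗ₜ _, TensorProduct.map_tmul ..⟩
  · refine sup_le (LinearMap.range_le_iff_comap.2 ?_) (LinearMap.range_le_iff_comap.2 ?_)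
    · refine eq_top_iff.2 fun z _ => ?_
      refine TensorProduct.induction_on z (zero_mem _) (fun x y => ?_) fun z z' => add_mem
      obtain ⟨x, hx⟩ := x
      have : decomposables M l.1 ≤
          (extDecomposables M N l).comap ((TensorProduct.mk K _ _).flip y) := by
        refine Submodule.span_le.2 ?_
        rintro _ ⟨b, m, h, hm, x, rfl⟩
        have := map_tmul_map_mem_extDecomposables M N (b := (b, l.2)) (m := (m, 0)) (l := l) h
          (add_zero _) (fun h0 => hm (congrArg Prod.fst h0)) x y
        rwa [map_zero_apply] at this
      exact this hx
    · refine eq_top_iff.2 fun z _ => ?_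
      refine TensorProduct.induction_on z (zero_mem _) (fun x y => ?_) fun z z' => add_mem
      obtain ⟨y, hy⟩ := y
      have : decomposables N l.2 ≤
          (extDecomposables M N l).comap (TensorProduct.mk K _ _ x) := by
        refine Submodule.span_le.2 ?_
        rintro _ ⟨b, m, h, hm, y, rfl⟩
        have := map_tmul_map_mem_extDecomposables M N (b := (l.1, b)) (m := (0, m)) (l := l)
          (add_zero _) h (fun h0 => hm (congrArg Prod.snd h0)) x y
        rwa [map_zero_apply] at this
      exact this hy

/-- Reduction modulo the nontrivial monomials commutes with external tensor products. -/
noncomputable def indecomposablesExtTensorEquiv (M : GrMod K L₁) (N : GrMod K L₂) (l : L₁ × L₂) :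
    ((M.obj ⟨l.1⟩ ⧸ decomposables M l.1) ⊗[K] (N.obj ⟨l.2⟩ ⧸ decomposables N l.2)) ≃ₗ[K]
      ((M.obj ⟨l.1⟩ ⊗[K] N.obj ⟨l.2⟩) ⧸ extDecomposables M N l) :=
  (TensorProduct.quotientTensorQuotientEquiv (decomposables M l.1) (decomposables N l.2)).trans
    (Submodule.quotEquivOfEq _ _ (extDecomposables_eq M N l).symm)

/-- `indecomposablesExtTensorEquiv` as an isomorphism between values of functors. -/
noncomputable def indecomposablesExtTensorIso (M : GrMod K L₁) (N : GrMod K L₂) (l : L₁ × L₂) :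
    ((ModuleCat.tensorBifunctor K).obj ((indecomposables K l.1).obj M)).obj
        ((indecomposables K l.2).obj N) ≅
      (indecomposables K l).obj ((extTensor.obj M).obj N) :=
  (indecomposablesExtTensorEquiv M N l).toModuleIso

theorem indecomposablesExtTensorIso_naturality_left {M M' : GrMod K L₁} (f : M ⟶ M')
    (N : GrMod K L₂) (l : L₁ × L₂) :
    ((ModuleCat.tensorBifunctor K).map ((indecomposables K l.1).map f)).app
        ((indecomposables K l.2).obj N) ≫ (indecomposablesExtTensorIso M' N l).hom =
      (indecomposablesExtTensorIso M N l).hom ≫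
        (indecomposables K l).map ((extTensor.map f).app N) := by
  ext : 1
  refine TensorProduct.ext (Submodule.linearMap_qext _ (LinearMap.ext fun x =>
    Submodule.linearMap_qext _ (LinearMap.ext fun y => rfl)))

theorem indecomposablesExtTensorIso_naturality_right (M : GrMod K L₁) {N N' : GrMod K L₂}
    (f : N ⟶ N') (l : L₁ × L₂) :
    ((ModuleCat.tensorBifunctor K).obj ((indecomposables K l.1).obj M)).map
        ((indecomposables K l.2).map f) ≫ (indecomposablesExtTensorIso M N' l).hom =
      (indecomposablesExtTensorIso M N l).hom ≫
        (indecomposables K l).map ((extTensor.obj M).map f) := by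
  ext : 1
  refine TensorProduct.ext (Submodule.linearMap_qext _ (LinearMap.ext fun x =>
    Submodule.linearMap_qext _ (LinearMap.ext fun y => rfl)))

end Indecomposables

section Residue

variable [IsPointedAffine L₁] [IsPointedAffine L₂]

/-- The multiplication of functions on two types `A` and `B`, restricted to a type `C` over
both. -/
noncomputable def _root_.LinearMap.tensorPiMul {A B C : Type*} (f : C → A) (g : C → B) :
    (A → K) ⊗[K] (B → K) →ₗ[K] (C → K) :=
  TensorProduct.lift (LinearMap.mk₂ K (fun x y c => x (f c) * y (g c))
    (fun _ _ _ => funext fun _ => add_mul _ _ _) (fun _ _ _ => funext fun _ => mul_assoc _ _ _)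
    (fun _ _ _ => funext fun _ => mul_add _ _ _)
    (fun _ _ _ => funext fun _ => mul_left_comm _ _ _))

/-- If `A` and `B` have a point, so does `C`, and both sides are `K`; otherwise both sides are
zero. -/
theorem _root_.LinearMap.tensorPiMul_bijective {A B C : Type*} [Subsingleton A] [Subsingleton B]
    [Subsingleton C] (f : C → A) (g : C → B) (h : A → B → C) :
    Function.Bijective (LinearMap.tensorPiMul (K := K) f g) := by
  by_cases hC : Nonempty C
  · obtain ⟨c⟩ := hC
    refine Function.bijective_iff_has_inverse.2
      ⟨fun z => (fun _ => z c : A → K) ⊗ₜ[K] (fun _ => 1 : B → K), fun z => ?_, fun z => ?_⟩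
    · induction z using TensorProduct.induction_on with
      | zero =>
        exact (congrArg (· ⊗ₜ _) (funext fun _ => by simp)).trans (TensorProduct.zero_tmul _ _)
      | tmul x y =>
        have h₁ : (fun _ => x (f c) * y (g c) : A → K) = y (g c) • x :=
          funext fun a => by simp [Subsingleton.elim a (f c), mul_comm]
        have h₂ : y = y (g c) • (fun _ => 1 : B → K) :=
          funext fun b => by simp [Subsingleton.elim b (g c)]
        refine (congrArg (· ⊗ₜ _) h₁).trans ?_
        rw [TensorProduct.smul_tmul, ← h₂]
      | add z z' hz hz' =>
        refine (congrArg (· ⊗ₜ _) (funext fun _ => ?_)).trans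
          ((TensorProduct.add_tmul _ _ _).trans (congrArg₂ (· + ·) hz hz'))
        rw [map_add]
        rfl
    · funext c'
      rw [Subsingleton.elim c' c]
      exact mul_one _
  · have hC' : IsEmpty C := not_nonempty_iff.1 hC
    have : Subsingleton ((A → K) ⊗[K] (B → K)) := by
      refine subsingleton_of_forall_eq 0 fun z => ?_
      induction z using TensorProduct.induction_on with
      | zero => rfl
      | tmul x y =>
        by_cases hA : IsEmpty A
        · rw [Subsingleton.elim x 0, TensorProduct.zero_tmul]
        · obtain ⟨a⟩ := not_isEmpty_iff.1 hA
          have : IsEmpty B := ⟨fun b => hC ⟨h a b⟩⟩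
          rw [Subsingleton.elim y 0, TensorProduct.tmul_zero]
      | add z z' hz hz' => rw [hz, hz', add_zero]
    exact ⟨Function.injective_of_subsingleton _, fun z => ⟨0, Subsingleton.elim _ _⟩⟩

variable (K L₁ L₂) in
/-- The multiplication map from the external tensor product of the residue fields. -/
noncomputable def residueMulHom :
    (extTensor.obj (residueField K L₁)).obj (residueField K L₂) ⟶ residueField K (L₁ × L₂) where
  app a := ModuleCat.ofHom (LinearMap.tensorPiMul
    (fun h : ULift.{max v w} (PLift (a.val = 0)) =>
      (⟨⟨congrArg Prod.fst h.down.down⟩⟩ : ULift.{v} (PLift (a.val.1 = 0))))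
    (fun h => (⟨⟨congrArg Prod.snd h.down.down⟩⟩ : ULift.{w} (PLift (a.val.2 = 0)))))
  naturality a b f := by
    ext : 1
    exact TensorProduct.ext' fun x y => rfl

theorem isIso_residueMulHom : IsIso (residueMulHom K L₁ L₂) := by
  refine (NatTrans.isIso_iff_isIso_app _).2 fun a => (ConcreteCategory.isIso_iff_bijective _).2 ?_
  exact LinearMap.tensorPiMul_bijective _ _ fun h₁ h₂ => ⟨⟨Prod.ext h₁.down.down h₂.down.down⟩⟩

variable (K L₁ L₂) in
/-- The residue field of `K[L₁ ⊕ L₂]` is the external tensor product of the residue fields. -/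
noncomputable def residueMulIso :
    (extTensor.obj (residueField K L₁)).obj (residueField K L₂) ≅ residueField K (L₁ × L₂) :=
  have := isIso_residueMulHom (K := K) (L₁ := L₁) (L₂ := L₂)
  asIso (residueMulHom K L₁ L₂)

theorem residueField_isLocallyFinite : IsLocallyFinite (residueField K L₁) := fun a =>
  inferInstanceAs (Module.Finite K (ULift.{v} (PLift (a.val = 0)) → K))

end Residue

end GrMod

/-! ### The product of two projective resolutions -/

namespace HomologicalComplex

section Single

variable {C₁ C₂ D : Type*} [Category* C₁] [Category* C₂] [Category* D]
  [Preadditive C₁] [Preadditive C₂] [Preadditive D] [HasFiniteCoproducts D]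
  [HasZeroObject C₁] [HasZeroObject C₂] [HasZeroObject D]
  (F : C₁ ⥤ C₂ ⥤ D) [F.Additive] [∀ X, (F.obj X).Additive] (X : C₁) (Y : C₂)

/-- Off total degree zero, one of the two arguments of `F` is a zero object in every summand. -/
theorem isZero_mapBifunctor_single_X {n : ℕ} (hn : n ≠ 0) :
    IsZero ((mapBifunctor ((ChainComplex.single₀ C₁).obj X) ((ChainComplex.single₀ C₂).obj Y) F
      (ComplexShape.down ℕ)).X n) := by
  refine (IsZero.iff_id_eq_zero _).2 (mapBifunctor.hom_ext fun i j h => IsZero.eq_of_src ?_ _ _)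
  by_cases hi : i = 0
  · have hj : j ≠ 0 := by
      rintro rfl
      exact hn (h.symm.trans (by rw [hi]; rfl))
    exact (F.obj _).map_isZero (isZero_single_obj_X _ _ _ _ hj)
  · exact (F.map_isZero (isZero_single_obj_X _ _ X _ hi)).obj _

omit [HasZeroObject C₁] [HasZeroObject C₂] [HasZeroObject D] in
/-- The component of degree zero of a total complex. -/
@[simps hom]
noncomputable def mapBifunctorXZeroIso (A : ChainComplex C₁ ℕ) (B : ChainComplex C₂ ℕ) :
    (F.obj (A.X 0)).obj (B.X 0) ≅ (mapBifunctor A B F (ComplexShape.down ℕ)).X 0 where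
  hom := ιMapBifunctor A B F (ComplexShape.down ℕ) 0 0 0 rfl
  inv := mapBifunctorDesc fun i j h => eqToHom (by
    obtain ⟨rfl, rfl⟩ := Nat.add_eq_zero_iff.1 h
    rfl)
  hom_inv_id := by rw [ι_mapBifunctorDesc, eqToHom_refl]
  inv_hom_id := by
    refine mapBifunctor.hom_ext fun i j h => ?_
    obtain ⟨rfl, rfl⟩ := Nat.add_eq_zero_iff.1 h
    rw [ι_mapBifunctorDesc_assoc, eqToHom_refl, Category.id_comp, Category.comp_id]

/-- The total complex of a bicomplex concentrated in bidegree `(0, 0)`. -/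
noncomputable def mapBifunctorSingleHom :
    mapBifunctor ((ChainComplex.single₀ C₁).obj X) ((ChainComplex.single₀ C₂).obj Y) F
      (ComplexShape.down ℕ) ⟶ (ChainComplex.single₀ D).obj ((F.obj X).obj Y) :=
  (ChainComplex.toSingle₀Equiv _ _).symm ⟨(mapBifunctorXZeroIso F ((ChainComplex.single₀ C₁).obj X)
    ((ChainComplex.single₀ C₂).obj Y)).inv,
    (isZero_mapBifunctor_single_X F X Y one_ne_zero).eq_of_src _ _⟩

instance : IsIso (mapBifunctorSingleHom F X Y) := by
  have (n : ℕ) : IsIso ((mapBifunctorSingleHom F X Y).f n) := by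
    by_cases hn : n = 0
    · subst hn
      let e := mapBifunctorXZeroIso F ((ChainComplex.single₀ C₁).obj X)
        ((ChainComplex.single₀ C₂).obj Y)
      have he : (mapBifunctorSingleHom F X Y).f 0 = e.inv :=
        ChainComplex.toSingle₀Equiv_symm_apply_f_zero ..
      exact (congrArg (fun f => IsIso f) he).mpr (Iso.isIso_inv e)
    · exact ⟨0, (isZero_mapBifunctor_single_X F X Y hn).eq_of_src _ _,
        (isZero_single_obj_X _ _ _ _ hn).eq_of_src _ _⟩
  exact Hom.isIso_of_components _

end Single

section Naturality

variable {C₁ C₂ D C₁' C₂' D' : Type*} [Category* C₁] [Category* C₂] [Category* D]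
  [Category* C₁'] [Category* C₂'] [Category* D']
  [Preadditive C₁] [Preadditive C₂] [Preadditive D] [HasFiniteCoproducts D]
  [Preadditive C₁'] [Preadditive C₂'] [Preadditive D'] [HasFiniteCoproducts D']
  {F : C₁ ⥤ C₂ ⥤ D} [F.Additive] [∀ X, (F.obj X).Additive]
  {F' : C₁' ⥤ C₂' ⥤ D'} [F'.Additive] [∀ X, (F'.obj X).Additive]
  {G : D ⥤ D'} [G.Additive]
  {K₁ L₁ : ChainComplex C₁ ℕ} {K₂ L₂ : ChainComplex C₂ ℕ}
  {K₁' L₁' : ChainComplex C₁' ℕ} {K₂' L₂' : ChainComplex C₂' ℕ}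

theorem mapBifunctorComparison_naturality
    (φ : ∀ i j, (F'.obj (K₁'.X i)).obj (K₂'.X j) ⟶ G.obj ((F.obj (K₁.X i)).obj (K₂.X j)))
    (hφ₁ hφ₂)
    (ψ : ∀ i j, (F'.obj (L₁'.X i)).obj (L₂'.X j) ⟶ G.obj ((F.obj (L₁.X i)).obj (L₂.X j)))
    (hψ₁ hψ₂) (f₁ : K₁ ⟶ L₁) (f₂ : K₂ ⟶ L₂) (f₁' : K₁' ⟶ L₁') (f₂' : K₂' ⟶ L₂')
    (h : ∀ i j, (F'.map (f₁'.f i)).app (K₂'.X j) ≫ (F'.obj (L₁'.X i)).map (f₂'.f j) ≫ ψ i j =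
      φ i j ≫ G.map ((F.map (f₁.f i)).app (K₂.X j) ≫ (F.obj (L₁.X i)).map (f₂.f j))) :
    mapBifunctorMap f₁' f₂' F' (ComplexShape.down ℕ) ≫
        mapBifunctorComparison (F := F) (F' := F') (G := G) ψ hψ₁ hψ₂ =
      mapBifunctorComparison (F := F) (F' := F') (G := G) φ hφ₁ hφ₂ ≫
        (G.mapHomologicalComplex _).map (mapBifunctorMap f₁ f₂ F (ComplexShape.down ℕ)) := by
  ext n : 1
  change (mapBifunctorMap f₁' f₂' F' (ComplexShape.down ℕ)).f n ≫ mapBifunctorComparisonX ψ n =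
    mapBifunctorComparisonX φ n ≫ G.map ((mapBifunctorMap f₁ f₂ F (ComplexShape.down ℕ)).f n)
  refine mapBifunctor.hom_ext fun i j hn => ?_
  rw [ι_mapBifunctorMap_assoc, ι_mapBifunctorComparisonX _ _ _ _ hn,
    ι_mapBifunctorComparisonX_assoc _ _ _ _ hn, ← G.map_comp, ι_mapBifunctorMap]
  simp only [Functor.map_comp] at h ⊢
  rw [reassoc_of% (h i j)]

end Naturality

end HomologicalComplex

namespace GrMod

open HomologicalComplex

section ProductResolution

variable {K : Type u} [Field K] {L₁ : Type v} [AddCommMonoid L₁] {L₂ : Type w} [AddCommMonoid L₂]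

/-- Each component is a coproduct of external tensor products of projectives. -/
theorem projective_mapBifunctor_extTensor_X (P : ChainComplex (GrMod K L₁) ℕ)
    (Q : ChainComplex (GrMod K L₂) ℕ) [∀ n, Projective (P.X n)] [∀ n, Projective (Q.X n)] (n : ℕ) :
    Projective ((mapBifunctor P Q extTensor (ComplexShape.down ℕ)).X n) where
  factors f e _ := ⟨mapBifunctorDesc fun i j h =>
    Projective.factorThru (ιMapBifunctor P Q extTensor (ComplexShape.down ℕ) i j n h ≫ f) e,
    mapBifunctor.hom_ext fun i j h => by rw [ι_mapBifunctorDesc_assoc, Projective.factorThru_comp]⟩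

variable (K) in
/-- The functor sending a graded module to its degree `a` part. -/
abbrev evalDeg {L : Type v} [AddCommMonoid L] (a : Deg L) : GrMod K L ⥤ ModuleCat.{max u v} K :=
  (evaluation (Deg L) (ModuleCat.{max u v} K)).obj a

/-- A projective resolution splits in each degree over the field `K`. -/
theorem exists_homotopyEquiv_evaluation {M : GrMod K L₁} (P : ProjectiveResolution M)
    (a : Deg L₁) : ∃ e : HomotopyEquiv
      (((evalDeg K a).mapHomologicalComplex _).obj P.complex)
      (((evalDeg K a).mapHomologicalComplex _).obj ((ChainComplex.single₀ (GrMod K L₁)).obj M)),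
      e.hom = ((evalDeg K a).mapHomologicalComplex _).map P.π := by
  let E := evalDeg K a
  have hp (V : ModuleCat.{max u v} K) : Projective V :=
    (IsProjective.iff_projective V).1
      (have : Module.Free K V := Module.Free.of_divisionRing K V; Module.Projective.of_free)
  have : E.PreservesProjectiveObjects := ⟨fun _ => hp _⟩
  let s := (HomologicalComplex.singleMapHomologicalComplex E (ComplexShape.down ℕ) 0).app M
  let P' := E.mapProjectiveResolution P
  have := hp (E.obj M)
  have hπ : (ProjectiveResolution.homotopyEquiv P' (ProjectiveResolution.self (E.obj M))).hom =
      (E.mapHomologicalComplex _).map P.π ≫ s.hom :=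
    (Category.comp_id _).symm.trans (ProjectiveResolution.homotopyEquiv_hom_π P' _)
  refine ⟨(ProjectiveResolution.homotopyEquiv P' (ProjectiveResolution.self (E.obj M))).trans
    (HomotopyEquiv.ofIso s.symm), ?_⟩
  refine (congrArg (· ≫ s.inv) hπ).trans ?_
  exact (Category.assoc _ _ _).trans ((congrArg _ s.hom_inv_id).trans (Category.comp_id _))

/-- The degree `a` part of an external tensor product. -/
noncomputable def evaluationExtTensorIso (M : GrMod K L₁) (N : GrMod K L₂) (a : Deg (L₁ × L₂)) :
    ((ModuleCat.tensorBifunctor K).obj ((evalDeg K (⟨a.val.1⟩ : Deg L₁)).obj M)).obj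
        ((evalDeg K (⟨a.val.2⟩ : Deg L₂)).obj N) ≅
      (evalDeg K a).obj ((extTensor.obj M).obj N) :=
  Iso.refl _

theorem evaluationExtTensorIso_naturality_left {M M' : GrMod K L₁} (f : M ⟶ M') (N : GrMod K L₂)
    (a : Deg (L₁ × L₂)) :
    ((ModuleCat.tensorBifunctor K).map ((evalDeg K (⟨a.val.1⟩ : Deg L₁)).map f)).app
        ((evalDeg K (⟨a.val.2⟩ : Deg L₂)).obj N) ≫ (evaluationExtTensorIso M' N a).hom =
      (evaluationExtTensorIso M N a).hom ≫ (evalDeg K a).map ((extTensor.map f).app N) :=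
  rfl

theorem evaluationExtTensorIso_naturality_right (M : GrMod K L₁) {N N' : GrMod K L₂} (f : N ⟶ N')
    (a : Deg (L₁ × L₂)) :
    ((ModuleCat.tensorBifunctor K).obj ((evalDeg K (⟨a.val.1⟩ : Deg L₁)).obj M)).map
        ((evalDeg K (⟨a.val.2⟩ : Deg L₂)).map f) ≫ (evaluationExtTensorIso M N' a).hom =
      (evaluationExtTensorIso M N a).hom ≫ (evalDeg K a).map ((extTensor.obj M).map f) :=
  rfl

theorem evaluationExtTensorIso_naturality {M M' : GrMod K L₁} (f : M ⟶ M') {N N' : GrMod K L₂}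
    (g : N ⟶ N') (a : Deg (L₁ × L₂)) :
    ((ModuleCat.tensorBifunctor K).map ((evalDeg K (⟨a.val.1⟩ : Deg L₁)).map f)).app
        ((evalDeg K (⟨a.val.2⟩ : Deg L₂)).obj N) ≫
      ((ModuleCat.tensorBifunctor K).obj ((evalDeg K (⟨a.val.1⟩ : Deg L₁)).obj M')).map
        ((evalDeg K (⟨a.val.2⟩ : Deg L₂)).map g) ≫ (evaluationExtTensorIso M' N' a).hom =
      (evaluationExtTensorIso M N a).hom ≫ (evalDeg K a).map
        ((extTensor.map f).app N ≫ (extTensor.obj M').map g) := by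
  rw [evaluationExtTensorIso_naturality_right, ← Category.assoc,
    evaluationExtTensorIso_naturality_left, Category.assoc, ← Functor.map_comp]

/-- In each degree, the total complex of the external tensor product is the total complex of the
tensor product of complexes of vector spaces. -/
noncomputable def evaluationExtTensorHom (P : ChainComplex (GrMod K L₁) ℕ)
    (Q : ChainComplex (GrMod K L₂) ℕ) (a : Deg (L₁ × L₂)) :
    mapBifunctor (((evalDeg K (⟨a.val.1⟩ : Deg L₁)).mapHomologicalComplex _).obj P)
        (((evalDeg K (⟨a.val.2⟩ : Deg L₂)).mapHomologicalComplex _).obj Q)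
        (ModuleCat.tensorBifunctor K) (ComplexShape.down ℕ) ⟶
      ((evalDeg K a).mapHomologicalComplex _).obj
        (mapBifunctor P Q extTensor (ComplexShape.down ℕ)) :=
  mapBifunctorComparison (G := evalDeg K a) (F := extTensor) (F' := ModuleCat.tensorBifunctor K)
    (K₁' := ((evalDeg K (⟨a.val.1⟩ : Deg L₁)).mapHomologicalComplex _).obj P)
    (K₂' := ((evalDeg K (⟨a.val.2⟩ : Deg L₂)).mapHomologicalComplex _).obj Q)
    (fun i j => (evaluationExtTensorIso (P.X i) (Q.X j) a).hom)
    (fun i i' j => evaluationExtTensorIso_naturality_left (P.d i i') (Q.X j) a)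
    (fun i j j' => evaluationExtTensorIso_naturality_right (P.X i) (Q.d j j') a)

instance (P : ChainComplex (GrMod K L₁) ℕ) (Q : ChainComplex (GrMod K L₂) ℕ)
    (a : Deg (L₁ × L₂)) : IsIso (evaluationExtTensorHom P Q a) :=
  isIso_mapBifunctorComparison (G := evalDeg K a) (F := extTensor)
    (F' := ModuleCat.tensorBifunctor K)
    (K₁' := ((evalDeg K (⟨a.val.1⟩ : Deg L₁)).mapHomologicalComplex _).obj P)
    (K₂' := ((evalDeg K (⟨a.val.2⟩ : Deg L₂)).mapHomologicalComplex _).obj Q)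
    (fun i j => evaluationExtTensorIso (P.X i) (Q.X j) a) _ _

theorem evaluationExtTensorHom_naturality {P P' : ChainComplex (GrMod K L₁) ℕ}
    {Q Q' : ChainComplex (GrMod K L₂) ℕ} (f : P ⟶ P') (g : Q ⟶ Q') (a : Deg (L₁ × L₂)) :
    mapBifunctorMap (((evalDeg K (⟨a.val.1⟩ : Deg L₁)).mapHomologicalComplex _).map f)
        (((evalDeg K (⟨a.val.2⟩ : Deg L₂)).mapHomologicalComplex _).map g)
        (ModuleCat.tensorBifunctor K) (ComplexShape.down ℕ) ≫ evaluationExtTensorHom P' Q' a =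
      evaluationExtTensorHom P Q a ≫ ((evalDeg K a).mapHomologicalComplex _).map
          (mapBifunctorMap f g extTensor (ComplexShape.down ℕ)) :=
  mapBifunctorComparison_naturality (G := evalDeg K a) (F := extTensor)
    (F' := ModuleCat.tensorBifunctor K)
    (K₁' := ((evalDeg K (⟨a.val.1⟩ : Deg L₁)).mapHomologicalComplex _).obj P)
    (K₂' := ((evalDeg K (⟨a.val.2⟩ : Deg L₂)).mapHomologicalComplex _).obj Q)
    (L₁' := ((evalDeg K (⟨a.val.1⟩ : Deg L₁)).mapHomologicalComplex _).obj P')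
    (L₂' := ((evalDeg K (⟨a.val.2⟩ : Deg L₂)).mapHomologicalComplex _).obj Q')
    (fun i j => (evaluationExtTensorIso (P.X i) (Q.X j) a).hom) _ _
    (fun i j => (evaluationExtTensorIso (P'.X i) (Q'.X j) a).hom) _ _ f g
    (((evalDeg K (⟨a.val.1⟩ : Deg L₁)).mapHomologicalComplex _).map f)
    (((evalDeg K (⟨a.val.2⟩ : Deg L₂)).mapHomologicalComplex _).map g)
    fun i j => evaluationExtTensorIso_naturality (f.f i) (g.f j) a

/-- External tensor products over a field are exact: in each degree the augmentations of the
resolutions are homotopy equivalences of complexes of vector spaces, and these are stable under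
tensor products. -/
theorem quasiIso_mapBifunctorMap_extTensor {M : GrMod K L₁} {N : GrMod K L₂}
    (P : ProjectiveResolution M) (Q : ProjectiveResolution N) :
    QuasiIso (mapBifunctorMap P.π Q.π extTensor (ComplexShape.down ℕ)) := by
  refine (HomologicalComplex.quasiIso_iff_evaluation _).2 fun a => ?_
  obtain ⟨e₁, h₁⟩ := exists_homotopyEquiv_evaluation P ⟨a.val.1⟩
  obtain ⟨e₂, h₂⟩ := exists_homotopyEquiv_evaluation Q ⟨a.val.2⟩
  have h : (mapBifunctorHomotopyEquiv (ModuleCat.tensorBifunctor K) e₁ e₂).hom ≫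
      evaluationExtTensorHom _ _ a = evaluationExtTensorHom P.complex Q.complex a ≫
        ((evalDeg K a).mapHomologicalComplex _).map
          (mapBifunctorMap P.π Q.π extTensor (ComplexShape.down ℕ)) := by
    rw [mapBifunctorHomotopyEquiv_hom, h₁, h₂]
    exact evaluationExtTensorHom_naturality P.π Q.π a
  -- the left hand side of `h` is a homotopy equivalence followed by an isomorphism
  have : QuasiIso (evaluationExtTensorHom P.complex Q.complex a ≫
      ((evalDeg K a).mapHomologicalComplex _).map
        (mapBifunctorMap P.π Q.π extTensor (ComplexShape.down ℕ))) := h ▸ inferInstance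
  exact quasiIso_of_comp_left (evaluationExtTensorHom P.complex Q.complex a) _

/-- The total complex of the external tensor product of two projective resolutions, as a
projective resolution of the external tensor product. -/
noncomputable def productResolution {M : GrMod K L₁} {N : GrMod K L₂}
    (P : ProjectiveResolution M) (Q : ProjectiveResolution N) :
    ProjectiveResolution ((extTensor.obj M).obj N) where
  complex := mapBifunctor P.complex Q.complex extTensor (ComplexShape.down ℕ)
  projective := projective_mapBifunctor_extTensor_X _ _
  π := mapBifunctorMap P.π Q.π extTensor (ComplexShape.down ℕ) ≫ mapBifunctorSingleHom extTensor M N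
  quasiIso :=
    have := quasiIso_mapBifunctorMap_extTensor P Q
    inferInstance

end ProductResolution

section Tor

variable {K : Type u} [Field K] {L : Type v} [AddCommMonoid L] [IsPointedAffine L]

/-- `Tor_{i,l}(K, K)` is the homology of the indecomposables of any projective resolution. -/
noncomputable def residueTorIso (P : ProjectiveResolution (residueField K L)) (i : ℕ) (l : L) :
    residueTor K i l ≅
      (((indecomposables K l).mapHomologicalComplex _).obj P.complex).homology i :=
  P.isoLeftDerivedObj (tensorDeg (residueField K L) l) i ≪≫
    (homologyFunctor _ _ i).mapIso
      ((NatIso.mapHomologicalComplex (tensorResidueIso l) (ComplexShape.down ℕ)).app P.complex)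

end Tor

section Kunneth

variable {K : Type u} [Field K] {L₁ : Type v} [AddCommMonoid L₁] {L₂ : Type w} [AddCommMonoid L₂]

/-- The complex of indecomposables of the total complex of an external tensor product. -/
noncomputable def indecomposablesExtTensorHom (P : ChainComplex (GrMod K L₁) ℕ)
    (Q : ChainComplex (GrMod K L₂) ℕ) (l : L₁ × L₂) :
    mapBifunctor (((indecomposables K l.1).mapHomologicalComplex _).obj P)
        (((indecomposables K l.2).mapHomologicalComplex _).obj Q)
        (ModuleCat.tensorBifunctor K) (ComplexShape.down ℕ) ⟶
      ((indecomposables K l).mapHomologicalComplex _).obj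
        (mapBifunctor P Q extTensor (ComplexShape.down ℕ)) :=
  mapBifunctorComparison (G := indecomposables K l) (F := extTensor)
    (F' := ModuleCat.tensorBifunctor K)
    (K₁' := ((indecomposables K l.1).mapHomologicalComplex _).obj P)
    (K₂' := ((indecomposables K l.2).mapHomologicalComplex _).obj Q)
    (fun i j => (indecomposablesExtTensorIso (P.X i) (Q.X j) l).hom)
    (fun i i' j => indecomposablesExtTensorIso_naturality_left (P.d i i') (Q.X j) l)
    (fun i j j' => indecomposablesExtTensorIso_naturality_right (P.X i) (Q.d j j') l)

instance (P : ChainComplex (GrMod K L₁) ℕ) (Q : ChainComplex (GrMod K L₂) ℕ)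
    (l : L₁ × L₂) : IsIso (indecomposablesExtTensorHom P Q l) :=
  isIso_mapBifunctorComparison (G := indecomposables K l) (F := extTensor)
    (F' := ModuleCat.tensorBifunctor K)
    (K₁' := ((indecomposables K l.1).mapHomologicalComplex _).obj P)
    (K₂' := ((indecomposables K l.2).mapHomologicalComplex _).obj Q)
    (fun i j => indecomposablesExtTensorIso (P.X i) (Q.X j) l) _ _

end Kunneth

end GrMod

/-! ### Betti numbers and Poincaré series -/

theorem ModuleCat.finite_homology {K : Type u} [Field K] (A : ChainComplex (ModuleCat.{v} K) ℕ)
    (i : ℕ) [Module.Finite K (A.X i)] : Module.Finite K (A.homology i) := by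
  have : Module.Finite K (A.cycles i) :=
    Module.Finite.of_injective (A.iCycles i).hom ((ModuleCat.mono_iff_injective _).1 inferInstance)
  exact Module.Finite.of_surjective (A.homologyπ i).hom
    ((ModuleCat.epi_iff_surjective _).1 inferInstance)

namespace GrMod

open HomologicalComplex

section Tor

variable {K : Type u} [Field K] {L : Type v} [AddCommMonoid L] [IsPointedAffine L]

variable (K) in
/-- The homology of the indecomposables of a resolution with finite-dimensional components. -/
theorem finite_residueTor (i : ℕ) (l : L) : Module.Finite K (residueTor K i l) := by
  let P := coverResolution (residueField K L)
  have h₁ : Module.Finite K ((P.complex.X i).obj ⟨l⟩) :=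
    coverResolution_isLocallyFinite residueField_isLocallyFinite i ⟨l⟩
  have h₂ : Module.Finite K ((((indecomposables K l).mapHomologicalComplex _).obj P.complex).X i) :=
    inferInstanceAs (Module.Finite K ((P.complex.X i).obj ⟨l⟩ ⧸ decomposables (P.complex.X i) l))
  have := ModuleCat.finite_homology (((indecomposables K l).mapHomologicalComplex _).obj P.complex) i
  exact Module.Finite.equiv (residueTorIso P i l).toLinearEquiv.symm

end Tor

section Product

variable (K : Type u) [Field K] {L₁ : Type v} [AddCommMonoid L₁] [IsPointedAffine L₁]
  {L₂ : Type w} [AddCommMonoid L₂] [IsPointedAffine L₂]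

variable (L₁ L₂) in
/-- A projective resolution of the residue field over `L₁ ⊕ L₂`, obtained from projective
resolutions over the two factors. -/
noncomputable def residueProductResolution (P : ProjectiveResolution (residueField K L₁))
    (Q : ProjectiveResolution (residueField K L₂)) :
    ProjectiveResolution (residueField K (L₁ × L₂)) where
  complex := (productResolution P Q).complex
  projective := (productResolution P Q).projective
  π := (productResolution P Q).π ≫ (ChainComplex.single₀ _).map (residueMulIso K L₁ L₂).hom

/-- The Künneth formula for the Betti numbers. -/
theorem betti_prod (i : ℕ) (l : L₁ × L₂) :
    betti K i l =
      ∑ p ∈ Finset.HasAntidiagonal.antidiagonal i, betti K p.1 l.1 * betti K p.2 l.2 := by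
  let P := coverResolution (residueField K L₁)
  let Q := coverResolution (residueField K L₂)
  let A := ((indecomposables K l.1).mapHomologicalComplex (ComplexShape.down ℕ)).obj P.complex
  let B := ((indecomposables K l.2).mapHomologicalComplex (ComplexShape.down ℕ)).obj Q.complex
  have eA (n : ℕ) : residueTor K n l.1 ≃ₗ[K] A.homology n := (residueTorIso P n l.1).toLinearEquiv
  have eB (n : ℕ) : residueTor K n l.2 ≃ₗ[K] B.homology n := (residueTorIso Q n l.2).toLinearEquiv
  have hA (n : ℕ) : Module.Finite K (A.homology n) :=
    have := finite_residueTor K n l.1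
    Module.Finite.equiv (eA n)
  have hB (n : ℕ) : Module.Finite K (B.homology n) :=
    have := finite_residueTor K n l.2
    Module.Finite.equiv (eB n)
  let e : residueTor K i l ≅
      (mapBifunctor A B (ModuleCat.tensorBifunctor K) (ComplexShape.down ℕ)).homology i :=
    residueTorIso (residueProductResolution K L₁ L₂ P Q) i l ≪≫
      (homologyFunctor _ _ i).mapIso (asIso (indecomposablesExtTensorHom P.complex Q.complex l)).symm
  refine e.toLinearEquiv.finrank_eq.trans
    ((ModuleCat.finrank_homology_mapBifunctor_tensor A B i).2.trans ?_)
  exact Finset.sum_congr rfl fun p _ => congrArg₂ (· * ·) (eA p.1).finrank_eq.symm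
    (eB p.2).finrank_eq.symm

end Product

end GrMod

/-- Only the decomposition `l = (l.1, 0) + (0, l.2)` contributes to the product. -/
theorem FormalSeries.coeff_inl_mul_inr {L₁ : Type v} [AddCommMonoid L₁] [IsPointedAffine L₁]
    {L₂ : Type w} [AddCommMonoid L₂] [IsPointedAffine L₂] (F : FormalSeries L₁)
    (G : FormalSeries L₂) (l : L₁ × L₂) :
    (F.inl L₂ * G.inr L₁).coeff l = F.coeff l.1 * G.coeff l.2 := by
  change ∑ p ∈ (IsPointedAffine.finite_antidiagonal l).toFinset,
    (F.inl L₂).coeff p.1 * (G.inr L₁).coeff p.2 = _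
  have hmem (p : (L₁ × L₂) × (L₁ × L₂)) :
      p ∈ (IsPointedAffine.finite_antidiagonal l).toFinset ↔ p.1 + p.2 = l :=
    Set.Finite.mem_toFinset (IsPointedAffine.finite_antidiagonal l)
  rw [Finset.sum_eq_single ((l.1, 0), (0, l.2))]
  · exact congrArg₂ (· * ·) (if_pos rfl) (if_pos rfl)
  · rintro ⟨p, q⟩ hpq hne
    have hpq : p + q = l := (hmem _).1 hpq
    by_cases hp : p.2 = 0
    · refine mul_eq_zero_of_right _ (if_neg fun hq => hne ?_)
      have hq : q.1 = 0 := hq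
      have h₁ : p.1 + q.1 = l.1 := congrArg Prod.fst hpq
      have h₂ : p.2 + q.2 = l.2 := congrArg Prod.snd hpq
      rw [hq, add_zero] at h₁
      rw [hp, zero_add] at h₂
      exact Prod.ext (Prod.ext h₁ hp) (Prod.ext hq h₂)
    · exact mul_eq_zero_of_left (if_neg hp) _
  · intro h
    exact absurd ((hmem _).2 (Prod.ext (add_zero _) (zero_add _))) h

theorem mainTheorem3 (K : Type u) [Field K]
    (L₁ : Type v) [AddCommMonoid L₁] [IsPointedAffine L₁]
    (L₂ : Type w) [AddCommMonoid L₂] [IsPointedAffine L₂] :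
    (∀ (i : ℕ) (l : L₁), Module.Finite K (residueTor K i l)) ∧
    (∀ (i : ℕ) (l : L₂), Module.Finite K (residueTor K i l)) ∧
    (∀ (i : ℕ) (l : L₁ × L₂), Module.Finite K (residueTor K i l)) ∧
    poincareSeries K (L₁ × L₂) =
      (poincareSeries K L₁).inl L₂ * (poincareSeries K L₂).inr L₁ := by
  refine ⟨GrMod.finite_residueTor K, GrMod.finite_residueTor K, GrMod.finite_residueTor K, ?_⟩
  refine FormalSeries.ext (funext fun l => PowerSeries.ext fun i => ?_)
  rw [FormalSeries.coeff_inl_mul_inr, PowerSeries.coeff_mul]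
  simp only [poincareSeries, PowerSeries.coeff_mk]
  rw [GrMod.betti_prod]
  push_cast
  rfl
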